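/- Let $X$ be an affine space over a real vector space $U$ of finite dimension $n$, and let $\alpha_1,\dots,\alpha_k\in U$ be linearly independent. Let $\mathbb R_+=[0,\infty)$ and let $\mathbb R^k$ act on $X\times\mathbb R_+^k$ by the antidiagonal action $$(s_1,\dots,s_k)\cdot(x,(\lambda_1,\dots,\lambda_k))=\Bigl(x-\sum_{i=1}^k s_i\alpha_i,\ (e^{s_1}\lambda_1,\dots,e^{s_k}\lambda_k)\Bigr).$$ This action is free and proper, and the quotient $\overline X_A=(X\times\mathbb R_+^k)/\mathbb R^k$, with the quotient topology and the quotient smooth structure (a function on an open subset is smooth if and only if its pullback to $X\times\mathbb R_+^k$ is smooth), is a smooth (Hausdorff, second countable) $n$-dimensional manifold with corners, whose boundary is the union of the hypersurfaces $D_i=\{[(x,\lambda)]:\lambda_i=0\}$, $1\le i\le k$. The residual action $[(x,\lambda)]+u=[(x+u,\lambda)]$ of $U$ makes $\overline X_A$ a complete log affine manifold with divisor $D=\bigcup_i D_i$. That is: $D$ is a free divisor (a union of smooth closed hypersurfaces for which the sheaf $T\overline X_A(-\log D)$ of vector fields tangent to all $D_i$ is locally free), the residual action is smooth, with infinitesimal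 action $\rho$ of the abelian Lie algebra $U$, and there is an isomorphism of Lie algebroids $\xi: T\overline X_A(-\log D)\to U\ltimes_\rho\overline X_A$ onto the action algebroid. Moreover the residue along $D_i$ of $\xi$, viewed as a logarithmic $U$-valued $1$-form on $\overline X_A$, is the constant $\alpha_i$, for each $i=1,\dots,k$. -/

import Mathlib

open Set Topology
open scoped Manifold ContDiff

/-! ### The quotient `(X × ℝ₊ᵏ) / ℝᵏ` and its residual translation action -/

section Quotient

variable {U : Type*} (X : Type*) [NormedAddCommGroup U] [NormedSpace ℝ U] [MetricSpace X]
  [NormedAddTorsor U X] {k : ℕ}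

/-- The space `X × ℝ₊ᵏ`, where `X` is an affine space over `U`. The vectors `α₁, …, αₖ ∈ U` are
recorded in the type because the action of `ℝᵏ` depends on them. -/
def CornerSpace (_α : Fin k → U) : Type _ := X × EuclideanQuadrant k

noncomputable instance (α : Fin k → U) : TopologicalSpace (CornerSpace X α) :=
  inferInstanceAs (TopologicalSpace (X × EuclideanQuadrant k))

/-- `(e^{s₁} λ₁, …, e^{sₖ} λₖ)`. -/
noncomputable def expScale (s : Fin k → ℝ) (l : EuclideanQuadrant k) : EuclideanQuadrant k :=
  ⟨WithLp.toLp 2 fun i => Real.exp (s i) * l.1 i,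
    fun i => mul_nonneg (Real.exp_pos _).le (l.2 i)⟩

/-- The antidiagonal action of `ℝᵏ` on `X × ℝ₊ᵏ`:
`s · (x, λ) = (x - ∑ sᵢ αᵢ, (e^{s₁} λ₁, …, e^{sₖ} λₖ))`. -/
noncomputable instance antidiagonalAction (α : Fin k → U) :
    AddAction (Fin k → ℝ) (CornerSpace X α) where
  vadd s p := (-(∑ i, s i • α i) +ᵥ p.1, expScale s p.2)
  zero_vadd p := by
    refine Prod.ext ?_ (EuclideanQuadrant.ext _ _ ?_)
    · change -(∑ i, (0 : Fin k → ℝ) i • α i) +ᵥ p.1 = p.1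
      simp
    · ext i
      change Real.exp ((0 : Fin k → ℝ) i) * p.2.1 i = p.2.1 i
      simp
  add_vadd s t p := by
    refine Prod.ext ?_ (EuclideanQuadrant.ext _ _ ?_)
    · change -(∑ i, (s + t) i • α i) +ᵥ p.1
        = -(∑ i, s i • α i) +ᵥ (-(∑ i, t i • α i) +ᵥ p.1)
      simp only [Pi.add_apply, add_smul, Finset.sum_add_distrib, neg_add, vadd_vadd]
    · ext i
      change Real.exp ((s + t) i) * p.2.1 i = Real.exp (s i) * (Real.exp (t i) * p.2.1 i)
      simp only [Pi.add_apply, Real.exp_add, mul_assoc]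

/-- The quotient `X̄_A = (X × ℝ₊ᵏ) / ℝᵏ` by the antidiagonal action. -/
def CornerCompactification (α : Fin k → U) : Type _ :=
  AddAction.orbitRel.Quotient (Fin k → ℝ) (CornerSpace X α)

noncomputable instance (α : Fin k → U) : TopologicalSpace (CornerCompactification X α) :=
  inferInstanceAs (TopologicalSpace (Quotient (AddAction.orbitRel (Fin k → ℝ) (CornerSpace X α))))

variable {X}

namespace CornerCompactification

/-- The class `[(x, λ)]`. -/
noncomputable def mk (α : Fin k → U) (x : X) (l : EuclideanQuadrant k) : CornerCompactification X α :=
  Quotient.mk (AddAction.orbitRel (Fin k → ℝ) (CornerSpace X α)) (x, l)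

/-- The residual action `[(x, λ)] + u = [(x + u, λ)]` of `U` on the quotient. -/
noncomputable instance residualAction (α : Fin k → U) : AddAction U (CornerCompactification X α) where
  vadd u := Quotient.map' (fun p : X × EuclideanQuadrant k => (u +ᵥ p.1, p.2)) (by
    rintro a b ⟨s, hs⟩
    refine ⟨s, ?_⟩
    have h1 : -(∑ i, s i • α i) +ᵥ b.1 = a.1 := congrArg Prod.fst hs
    have h2 : expScale s b.2 = a.2 := congrArg Prod.snd hs
    refine Prod.ext ?_ h2
    change -(∑ i, s i • α i) +ᵥ (u +ᵥ b.1) = u +ᵥ a.1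
    rw [← h1, vadd_comm])
  zero_vadd q := by
    induction q using Quotient.inductionOn with
    | h p => exact congrArg (Quotient.mk _) (Prod.ext (zero_vadd U p.1) rfl)
  add_vadd u v q := by
    induction q using Quotient.inductionOn with
    | h p => exact congrArg (Quotient.mk _) (Prod.ext (add_vadd u v p.1) rfl)

theorem vadd_mk (α : Fin k → U) (u : U) (x : X) (l : EuclideanQuadrant k) :
    u +ᵥ mk α x l = mk α (u +ᵥ x) l := rfl

variable (X) in
/-- The `i`-th boundary hypersurface `{[(x, λ)] : λᵢ = 0}`, i.e. the closure of the `i`-th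
codimension one stratum. -/
def boundaryStratum (α : Fin k → U) (i : Fin k) : Set (CornerCompactification X α) :=
  {q | ∃ (x : X) (l : EuclideanQuadrant k), l.1 i = 0 ∧ q = mk α x l}

end CornerCompactification

end Quotient

/-! ### Log affine manifolds

A smooth `n`-manifold with corners is a manifold modelled on the quadrant `ℝ₊ⁿ`. -/

local notation "𝓠" => modelWithCornersEuclideanQuadrant

section LogAffine

variable {n : ℕ} {M : Type*} [TopologicalSpace M] [ChartedSpace (EuclideanQuadrant n) M]

/-- A smooth closed hypersurface: a closed subset which near each of its points is a level set of
one coordinate of a smooth chart (a boundary coordinate, at level `0`, or an interior one). -/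
def IsSmoothHypersurface (n : ℕ) {M : Type*} [TopologicalSpace M]
    [ChartedSpace (EuclideanQuadrant n) M] (H : Set M) : Prop :=
  IsClosed H ∧ ∀ p ∈ H, ∃ e ∈ IsManifold.maximalAtlas (𝓠 n) ∞ M, p ∈ e.source ∧
    ∃ j : Fin n, ∀ q ∈ e.source, q ∈ H ↔ (e q).1 j = (e p).1 j

/-- `v ∈ T_q M` is tangent to `H` at `q ∈ H`: it is annihilated by the differential of every
function that is smooth near `q` and vanishes on `H` near `q`. -/
def IsTangentTo (H : Set M) (q : M) (v : TangentSpace (𝓠 n) q) : Prop :=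
  ∀ f : M → ℝ, ContMDiffAt (𝓠 n) 𝓘(ℝ, ℝ) ∞ f q → (∀ᶠ y in 𝓝[H] q, f y = 0) →
    mfderiv (𝓠 n) 𝓘(ℝ, ℝ) f q v = 0

/-- The derivative `v(f)` of a vector-valued function `f` along the tangent vector `v ∈ T_q M`. -/
noncomputable def derivAlong {F : Type*} [NormedAddCommGroup F] [NormedSpace ℝ F] (f : M → F)
    (q : M) (v : TangentSpace (𝓠 n) q) : F :=
  mfderiv (𝓠 n) 𝓘(ℝ, F) f q v

variable [IsManifold (𝓠 n) ∞ M] {ι : Type*}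

/-- `V` restricts to a section over the open set `W` of the sheaf `TM(-log D)`, where
`D = ⋃ i, D i`: it is smooth on `W` and tangent to all the hypersurfaces `D i`.
Values of `V` outside `W` are irrelevant. -/
def IsLogVectorField (D : ι → Set M) (W : Set M) (V : Π q : M, TangentSpace (𝓠 n) q) : Prop :=
  ContMDiffOn (𝓠 n) (𝓠 n).tangent ∞ (fun q => (⟨q, V q⟩ : TangentBundle (𝓠 n) M)) W ∧
    ∀ i, ∀ q ∈ W ∩ D i, IsTangentTo (D i) q (V q)

/-- `D = ⋃ i, D i` is a free divisor: a locally finite union of smooth closed hypersurfaces such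
that the sheaf `TM(-log D)` is locally free, of rank `n`, over the sheaf of smooth functions. -/
structure IsFreeDivisor (n : ℕ) {M : Type*} [TopologicalSpace M]
    [ChartedSpace (EuclideanQuadrant n) M] [IsManifold (𝓠 n) ∞ M] (D : ι → Set M) : Prop where
  hypersurface : ∀ i, IsSmoothHypersurface n (D i)
  locallyFinite : LocallyFinite D
  locallyFree : ∀ p : M, ∃ W : Set M, IsOpen W ∧ p ∈ W ∧
    ∃ E : Fin n → Π q : M, TangentSpace (𝓠 n) q, (∀ j, IsLogVectorField D W (E j)) ∧
      ∀ W' ⊆ W, IsOpen W' → ∀ V, IsLogVectorField D W' V →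
        (∃ c : Fin n → M → ℝ, (∀ j, ContMDiffOn (𝓠 n) 𝓘(ℝ, ℝ) ∞ (c j) W') ∧
          ∀ q ∈ W', V q = ∑ j, c j q • E j q) ∧
        ∀ c c' : Fin n → M → ℝ, (∀ j, ContMDiffOn (𝓠 n) 𝓘(ℝ, ℝ) ∞ (c j) W') →
          (∀ j, ContMDiffOn (𝓠 n) 𝓘(ℝ, ℝ) ∞ (c' j) W') →
          (∀ q ∈ W', V q = ∑ j, c j q • E j q) → (∀ q ∈ W', V q = ∑ j, c' j q • E j q) →
          ∀ j, EqOn (c j) (c' j) W'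

/-- A log affine structure on the `n`-manifold with corners `M`, with divisor `D`: an infinitesimal
action `ρ` on `M` of the abelian Lie algebra `U`, together with an isomorphism `ξ` of Lie
algebroids from `TM(-log D)` to the action algebroid `U ⋉_ρ M`.

`ξ` is given as an isomorphism of the sheaves of sections. For `W` open and `V` a section of
`TM(-log D)` over `W`, `ξ W V` is the corresponding section of the trivial bundle `U × M` over `W`,
that is, the pairing of the logarithmic `U`-valued 1-form `ξ` with `V`. The values `ξ W V q` for
`q ∉ W`, or if `W` is not open or `V` is not a section of `TM(-log D)` over `W`, are irrelevant. -/
structure LogAffineStructure (n : ℕ) {M : Type*} [TopologicalSpace M]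
    [ChartedSpace (EuclideanQuadrant n) M] [IsManifold (𝓠 n) ∞ M] (D : ι → Set M)
    (U : Type*) [NormedAddCommGroup U] [NormedSpace ℝ U] where
  freeDivisor : IsFreeDivisor n D
  /-- the infinitesimal action -/
  ρ : U →ₗ[ℝ] Π q : M, TangentSpace (𝓠 n) q
  smooth_ρ : ∀ u, ContMDiff (𝓠 n) (𝓠 n).tangent ∞
    (fun q => (⟨q, ρ u q⟩ : TangentBundle (𝓠 n) M))
  lie_ρ : ∀ u v q, VectorField.mlieBracket (𝓠 n) (ρ u) (ρ v) q = 0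
  /-- the isomorphism of sheaves of sections -/
  ξ : Set M → (Π q : M, TangentSpace (𝓠 n) q) → M → U
  smooth_ξ : ∀ W V, IsOpen W → IsLogVectorField D W V →
    ContMDiffOn (𝓠 n) 𝓘(ℝ, U) ∞ (ξ W V) W
  /-- `ξ` is linear over smooth functions -/
  linear_ξ : ∀ W V V' (f g : M → ℝ), IsOpen W → IsLogVectorField D W V →
    IsLogVectorField D W V' → ContMDiffOn (𝓠 n) 𝓘(ℝ, ℝ) ∞ f W →
    ContMDiffOn (𝓠 n) 𝓘(ℝ, ℝ) ∞ g W → ∀ q ∈ W,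
      ξ W (fun y => f y • V y + g y • V' y) q = f q • ξ W V q + g q • ξ W V' q
  /-- `ξ` commutes with restrictions -/
  restrict_ξ : ∀ W W' V V', IsOpen W → IsOpen W' → W' ⊆ W → IsLogVectorField D W V →
    IsLogVectorField D W' V' → (∀ q ∈ W', V q = V' q) → EqOn (ξ W V) (ξ W' V') W'
  injective_ξ : ∀ W V V', IsOpen W → IsLogVectorField D W V → IsLogVectorField D W V' →
    EqOn (ξ W V) (ξ W V') W → ∀ q ∈ W, V q = V' q
  surjective_ξ : ∀ W (a : M → U), IsOpen W → ContMDiffOn (𝓠 n) 𝓘(ℝ, U) ∞ a W →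
    ∃ V, IsLogVectorField D W V ∧ EqOn (ξ W V) a W
  /-- `ξ` commutes with the anchors: the inclusion into vector fields for `TM(-log D)`, and
  `a ↦ (q ↦ ρ (a q) q)` for the action algebroid -/
  anchor_ξ : ∀ W V, IsOpen W → IsLogVectorField D W V → ∀ q ∈ W, ρ (ξ W V q) q = V q
  /-- `ξ` preserves brackets; since `U` is abelian, the bracket of sections `a, b` of the action
  algebroid is the derivative of `b` along the anchor of `a` minus that of `a` along the
  anchor of `b` -/
  bracket_ξ : ∀ W V V', IsOpen W → IsLogVectorField D W V → IsLogVectorField D W V' →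
    ∀ q ∈ W, ξ W (VectorField.mlieBracket (𝓠 n) V V') q =
      derivAlong (ξ W V') q (V q) - derivAlong (ξ W V) q (V' q)

namespace LogAffineStructure

variable {D : ι → Set M} {U : Type*} [NormedAddCommGroup U] [NormedSpace ℝ U]

/-- The infinitesimal action `ρ` is the derivative of the given smooth action of the group `U`:
for every `u` and `q`, the orbit `t ↦ t u + q` is an integral curve of `ρ u`. -/
def IntegratesTo (L : LogAffineStructure n D U) (act : AddAction U M) : Prop :=
  ContMDiff (𝓘(ℝ, U).prod (𝓠 n)) (𝓠 n) ∞ (fun p : U × M => p.1 +ᵥ p.2) ∧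
    ∀ (u : U) (q : M), IsMIntegralCurve (fun t : ℝ => (t • u) +ᵥ q) (L.ρ u)

/-- A log affine manifold is complete when its infinitesimal action integrates to a group
action. -/
def IsComplete (L : LogAffineStructure n D U) : Prop := ∃ act : AddAction U M, L.IntegratesTo act

/-- The residue of the logarithmic form `ξ` along `D i` is the function `r` (only its values on
`D i` matter). That is, near each point of `D i` there are a defining function `x` of `D i` and a
smooth extension `R` of `r` such that `ξ - x⁻¹ dx ⊗ R` has no pole along `D i`: its pairing with any
vector field tangent to the other hypersurfaces extends smoothly across `D i`. -/
def HasResidue (L : LogAffineStructure n D U) (i : ι) (r : M → U) : Prop :=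
  ∀ p ∈ D i, ∃ (W : Set M) (x : M → ℝ) (R : M → U), IsOpen W ∧ p ∈ W ∧
    ContMDiffOn (𝓠 n) 𝓘(ℝ, ℝ) ∞ x W ∧ (∀ q ∈ W, x q = 0 ↔ q ∈ D i) ∧
    (∀ q ∈ W ∩ D i, mfderiv (𝓠 n) 𝓘(ℝ, ℝ) x q ≠ 0) ∧
    ContMDiffOn (𝓠 n) 𝓘(ℝ, U) ∞ R W ∧ EqOn R r (W ∩ D i) ∧
    ∀ W' ⊆ W, IsOpen W' → ∀ V, IsLogVectorField (fun j : {j : ι // j ≠ i} => D j) W' V →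
      ∃ b : M → U, ContMDiffOn (𝓠 n) 𝓘(ℝ, U) ∞ b W' ∧ ∀ q ∈ W' \ D i,
        L.ξ (W' \ D i) V q = ((x q)⁻¹ * derivAlong x q (V q)) • R q + b q

end LogAffineStructure

end LogAffine

/-- The smooth structure on `X̄_A` is the quotient one: a function on an open subset is smooth if
and only if its pullback to `X × ℝ₊ᵏ` is smooth. The smooth structure on the affine space `X` is
expressed by identifying `X` with `U` by means of an arbitrary origin `o`. -/
def IsQuotientSmoothStructure {U X : Type*} [NormedAddCommGroup U] [NormedSpace ℝ U]
    [MetricSpace X] [NormedAddTorsor U X] {k : ℕ} (α : Fin k → U) (n : ℕ)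
    [ChartedSpace (EuclideanQuadrant n) (CornerCompactification X α)] : Prop :=
  ∀ (o : X) (W : Set (CornerCompactification X α)), IsOpen W →
    ∀ f : CornerCompactification X α → ℝ,
      let π : U × EuclideanQuadrant k → CornerCompactification X α :=
        fun p => CornerCompactification.mk α (p.1 +ᵥ o) p.2
      ContMDiffOn (𝓠 n) 𝓘(ℝ, ℝ) ∞ f W ↔
        ContMDiffOn (𝓘(ℝ, U).prod (𝓠 k)) 𝓘(ℝ, ℝ) ∞ (f ∘ π) (π ⁻¹' W)

/-!
Extend `α` to a basis `b` of `U` along an injection `σ`, so that `b (σ i) = α i`, choose an origin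
`o : X`, and let `tⱼ` be the coordinates of `x - o`. The functions `yⱼ = exp tⱼ * λᵢ` for `j = σ i`
and `yⱼ = exp tⱼ` for `j ∉ range σ` are invariant under the antidiagonal action and separate its
orbits (`cornerCoords_eq_iff`). They identify the quotient with the open subset
`{y | ∀ j ∉ range σ, 0 < yⱼ}` of the quadrant `ℝ₊ⁿ`, the inverse being given by an explicit section
(`CornerCompactification.chart`). Taking the exponential also of the directions complementary
to `α` thus makes a single chart with values in the quadrant suffice. Since the projection and the
section are both smooth, the resulting smooth structure is the quotient one.

In these coordinates `u ∈ U` acts by `yⱼ ↦ exp uⱼ * yⱼ`, the infinitesimal action is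
`ρ u = ∑ⱼ uⱼ yⱼ ∂ⱼ`, and the hypersurface `D i` is `y_{σ i} = 0`. A vector field `∑ⱼ Vⱼ ∂ⱼ` is
tangent to `D i` if and only if `V_{σ i}` vanishes there, and then `V_{σ i}` is smoothly divisible
by `y_{σ i}` by Hadamard's lemma, which has to be proved up to the corners
(`exists_contDiffOn_eq_coord_mul`). The other `yⱼ` are invertible. Therefore the logarithmic fields
are exactly the fields `q ↦ ρ (a q) q` with `a` a smooth `U`-valued function
(`IsAdaptedChart.exists_eq_scalingField`), and `a` is unique because the points with positive
coordinates are dense (`IsAdaptedChart.eqOn_of_scalingField_eq`). The isomorphism `ξ` sends such a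
field to `a`; all its properties follow from existence and uniqueness of `a`, the compatibility
with brackets from `[ρ a, ρ a'] = ρ (da'(ρ a) - da(ρ a'))`. As a form, `ξ = ∑ⱼ yⱼ⁻¹ dyⱼ ⊗ bⱼ`, whose
residue along `D i` is `b (σ i) = α i`.

Because the quotient has a single chart, its tangent bundle is literally trivial, and vector fields,
derivatives and brackets are computed in this chart.
-/

/-! ### Division of smooth functions on a quadrant by a coordinate -/

section ParametricIntegral

universe u

theorem continuousOn_integral_unitInterval {E : Type*} [TopologicalSpace E]
    [FirstCountableTopology E] {F : Type*} [NormedAddCommGroup F] [NormedSpace ℝ F]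
    {S : Set E} {h : E × ℝ → F}
    (hh : ContinuousOn h (S ×ˢ Icc (0 : ℝ) 1)) :
    ContinuousOn (fun y => ∫ t in (0 : ℝ)..1, h (y, t)) S := by
  rw [continuousOn_iff_continuous_domRestrict]
  let f : S → ℝ → F := fun y t => h (y, projIcc 0 1 zero_le_one t)
  have hf : Continuous (Function.uncurry f) := by
    refine hh.comp_continuous (by fun_prop) fun p => ⟨p.1.2, (projIcc 0 1 zero_le_one p.2).2⟩
  have := intervalIntegral.continuous_parametric_intervalIntegral_of_continuous'
    (μ := MeasureTheory.volume) hf 0 1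
  refine this.congr fun y => ?_
  refine intervalIntegral.integral_congr fun t ht => ?_
  rw [uIcc_of_le zero_le_one] at ht
  simp only [f, projIcc_of_mem zero_le_one ht]

theorem intervalIntegrable_unitInterval_of_continuousOn {E F : Type*} [TopologicalSpace E]
    [NormedAddCommGroup F] {S : Set E} {g : E × ℝ → F}
    (hg : ContinuousOn g (S ×ˢ Icc (0 : ℝ) 1)) {z : E} (hz : z ∈ S) :
    IntervalIntegrable (fun t => g (z, t)) MeasureTheory.volume 0 1 := by
  apply ContinuousOn.intervalIntegrable
  rw [uIcc_of_le zero_le_one]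
  exact hg.comp (by fun_prop) fun t ht => ⟨hz, ht⟩

variable {E : Type u} [NormedAddCommGroup E] [NormedSpace ℝ E]

theorem hasFDerivWithinAt_integral_unitInterval {F : Type*} [NormedAddCommGroup F]
    [NormedSpace ℝ F] [CompleteSpace F] {S : Set E} (hS : Convex ℝ S) {h : E × ℝ → F}
    {h' : E × ℝ → E →L[ℝ] F} (hh : ContinuousOn h (S ×ˢ Icc (0 : ℝ) 1))
    (hh' : ContinuousOn h' (S ×ˢ Icc (0 : ℝ) 1))
    (hd : ∀ y ∈ S, ∀ t ∈ Icc (0 : ℝ) 1, HasFDerivWithinAt (fun y => h (y, t)) (h' (y, t)) S y)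
    {y : E} (hy : y ∈ S) :
    HasFDerivWithinAt (fun y => ∫ t in (0 : ℝ)..1, h (y, t))
      (∫ t in (0 : ℝ)..1, h' (y, t)) S y := by
  refine .of_isLittleO <| Asymptotics.isLittleO_iff.2 fun ε hε => ?_
  -- by compactness of `[0, 1]`, the derivative varies by at most `ε`, uniformly in `t`
  obtain ⟨v, hv, hvε⟩ := isCompact_Icc.mem_uniformity_of_prod (f := fun y t => h' (y, t))
    hh' hy (Metric.dist_mem_uniformity hε)
  obtain ⟨δ, hδ, hδv⟩ := Metric.mem_nhdsWithin_iff.1 hv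
  filter_upwards [inter_mem_nhdsWithin S (Metric.ball_mem_nhds y hδ)] with z hz
  have key : ∀ t ∈ Icc (0 : ℝ) 1, ‖h (z, t) - h (y, t) - h' (y, t) (z - y)‖ ≤ ε * ‖z - y‖ := by
    intro t ht
    refine Convex.norm_image_sub_le_of_norm_hasFDerivWithin_le' (s := S ∩ Metric.ball y δ)
      (f := fun y => h (y, t)) (f' := fun y => h' (y, t))
      (fun x hx => (hd x hx.1 t ht).mono inter_subset_left) (fun x hx => ?_)
      (hS.inter (convex_ball y δ)) ⟨hy, Metric.mem_ball_self hδ⟩ hz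
    rw [← dist_eq_norm]
    exact (hvε x (hδv ⟨hx.2, hx.1⟩) t ht).le
  have i1 := intervalIntegrable_unitInterval_of_continuousOn hh hz.1
  have i2 := intervalIntegrable_unitInterval_of_continuousOn hh hy
  have i3 := intervalIntegrable_unitInterval_of_continuousOn hh' hy
  have i4 : IntervalIntegrable (fun t => h' (y, t) (z - y)) MeasureTheory.volume 0 1 :=
    ⟨i3.1.apply_continuousLinearMap _, i3.2.apply_continuousLinearMap _⟩
  rw [ContinuousLinearMap.intervalIntegral_apply i3, ← intervalIntegral.integral_sub i1 i2,
    ← intervalIntegral.integral_sub (i1.sub i2) i4]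
  refine (intervalIntegral.norm_integral_le_of_norm_le_const (C := ε * ‖z - y‖)
    fun t ht => ?_).trans (by simp)
  rw [uIoc_of_le zero_le_one] at ht
  exact key t ⟨ht.1.le, ht.2⟩

/-- The induction on the order of differentiability replaces `F` by `E →L[ℝ] F`, which is why both
spaces live in the same universe. -/
theorem contDiffOn_nat_integral_unitInterval {S : Set E} (hS : Convex ℝ S)
    (hu : UniqueDiffOn ℝ S) (m : ℕ) : ∀ {F : Type u} [NormedAddCommGroup F] [NormedSpace ℝ F]
    [CompleteSpace F] {h : E × ℝ → F}, ContDiffOn ℝ m h (S ×ˢ Icc (0 : ℝ) 1) →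
    ContDiffOn ℝ m (fun y => ∫ t in (0 : ℝ)..1, h (y, t)) S := by
  induction m with
  | zero =>
    intro F _ _ _ h hh
    exact contDiffOn_zero.2 (continuousOn_integral_unitInterval hh.continuousOn)
  | succ m ih =>
    intro F _ _ _ h hh
    have huI : UniqueDiffOn ℝ (S ×ˢ Icc (0 : ℝ) 1) := hu.prod (uniqueDiffOn_Icc zero_lt_one)
    let h' : E × ℝ → E →L[ℝ] F := fun p =>
      (fderivWithin ℝ h (S ×ˢ Icc (0 : ℝ) 1) p).comp (ContinuousLinearMap.inl ℝ E ℝ)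
    have hh' : ContDiffOn ℝ m h' (S ×ˢ Icc (0 : ℝ) 1) :=
      (hh.fderivWithin huI (by simp)).clm_comp contDiffOn_const
    have hd : ∀ y ∈ S, ∀ t ∈ Icc (0 : ℝ) 1,
        HasFDerivWithinAt (fun y => h (y, t)) (h' (y, t)) S y := by
      intro y hy t ht
      have h1 := ((hh.differentiableOn (by simp)) (y, t) ⟨hy, ht⟩).hasFDerivWithinAt
      exact h1.comp (t := S ×ˢ Icc (0 : ℝ) 1) y (hasFDerivAt_prodMk_left y t).hasFDerivWithinAt
        fun z hz => ⟨hz, ht⟩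
    have hD := fun y (hy : y ∈ S) => hasFDerivWithinAt_integral_unitInterval hS
      hh.continuousOn hh'.continuousOn hd hy
    push_cast
    refine (contDiffOn_succ_iff_fderivWithin hu).2
      ⟨fun y hy => (hD y hy).differentiableWithinAt, by simp, ?_⟩
    exact (ih hh').congr fun y hy => (hD y hy).fderivWithin (hu y hy)

/-- Integration over `[0, 1]` preserves smoothness in the parameter. The parameter set is only
assumed to be convex with unique derivatives, so that it may have corners. -/
theorem contDiffOn_integral_unitInterval {S : Set E} (hS : Convex ℝ S)
    (hu : UniqueDiffOn ℝ S) {F : Type u} [NormedAddCommGroup F] [NormedSpace ℝ F]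
    [CompleteSpace F] {h : E × ℝ → F} (hh : ContDiffOn ℝ ∞ h (S ×ˢ Icc (0 : ℝ) 1)) :
    ContDiffOn ℝ ∞ (fun y => ∫ t in (0 : ℝ)..1, h (y, t)) S :=
  contDiffOn_infty.2 fun m => contDiffOn_nat_integral_unitInterval hS hu m
    (hh.of_le (by exact_mod_cast le_top))

end ParametricIntegral

section Quadrant

variable {n : ℕ}

theorem uniqueDiffOn_quadrant_inter {O : Set (EuclideanSpace ℝ (Fin n))} (hO : IsOpen O) :
    UniqueDiffOn ℝ ({y : EuclideanSpace ℝ (Fin n) | ∀ i, 0 ≤ y i} ∩ O) := by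
  have := (modelWithCornersEuclideanQuadrant n).uniqueDiffOn
  rw [show range (modelWithCornersEuclideanQuadrant n) = _ from range_euclideanQuadrant n] at this
  exact this.inter hO

/-- The projection of `ℝⁿ` onto the hyperplane `yⱼ = 0` along the `j`-th axis. -/
noncomputable def zeroCoord (j : Fin n) :
    EuclideanSpace ℝ (Fin n) →L[ℝ] EuclideanSpace ℝ (Fin n) :=
  ContinuousLinearMap.id ℝ _ -
    (EuclideanSpace.proj j : EuclideanSpace ℝ (Fin n) →L[ℝ] ℝ).smulRight
      (EuclideanSpace.single j (1 : ℝ))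

theorem zeroCoord_apply (j : Fin n) (y : EuclideanSpace ℝ (Fin n)) :
    zeroCoord j y = y - y j • EuclideanSpace.single j (1 : ℝ) := rfl

theorem zeroCoord_apply_self (j : Fin n) (y : EuclideanSpace ℝ (Fin n)) :
    zeroCoord j y j = 0 := by
  simp [zeroCoord_apply]

theorem zeroCoord_nonneg (j : Fin n) {y : EuclideanSpace ℝ (Fin n)} (hy : ∀ i, 0 ≤ y i) (i) :
    0 ≤ zeroCoord j y i := by
  rcases eq_or_ne i j with rfl | h
  · exact (zeroCoord_apply_self i y).ge
  · simpa [zeroCoord_apply, h] using hy i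

theorem zeroCoord_eq_self {j : Fin n} {y : EuclideanSpace ℝ (Fin n)} (hy : y j = 0) :
    zeroCoord j y = y := by
  simp [zeroCoord_apply, hy]

/-- Local form of Hadamard's lemma on a convex relatively open subset of the quadrant which contains
the projections of its points to the face `yⱼ = 0`: the quotient is the average over `t ∈ [0, 1]`
of the derivative `∂ⱼF` along the segment from the projection of `y` to `y`. -/
theorem exists_eq_mul_of_convex {C : Set (EuclideanSpace ℝ (Fin n))} (hC : Convex ℝ C)
    (hu : UniqueDiffOn ℝ C) (j : Fin n) (hCj : ∀ y ∈ C, zeroCoord j y ∈ C)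
    {F : EuclideanSpace ℝ (Fin n) → ℝ} (hF : ContDiffOn ℝ ∞ F C)
    (h0 : ∀ y ∈ C, y j = 0 → F y = 0) :
    ∃ G : EuclideanSpace ℝ (Fin n) → ℝ, ContDiffOn ℝ ∞ G C ∧ ∀ y ∈ C, F y = y j * G y := by
  let p : EuclideanSpace ℝ (Fin n) × ℝ → EuclideanSpace ℝ (Fin n) := fun q =>
    zeroCoord j q.1 + q.2 • (q.1 - zeroCoord j q.1)
  have hp : ContDiff ℝ ∞ p := by
    have := (zeroCoord j).contDiff (n := ∞)
    fun_prop
  have hpC : ∀ q ∈ C ×ˢ Icc (0 : ℝ) 1, p q ∈ C := fun q hq =>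
    hC.add_smul_sub_mem (hCj _ hq.1) hq.1 hq.2
  let h : EuclideanSpace ℝ (Fin n) × ℝ → ℝ := fun q =>
    fderivWithin ℝ F C (p q) (EuclideanSpace.single j 1)
  have hh : ContDiffOn ℝ ∞ h (C ×ˢ Icc (0 : ℝ) 1) :=
    ((hF.fderivWithin hu (by simp)).comp hp.contDiffOn hpC).clm_apply contDiffOn_const
  refine ⟨fun y => ∫ t in (0 : ℝ)..1, h (y, t), contDiffOn_integral_unitInterval hC hu hh,
    fun y hy => ?_⟩
  have hd : ∀ t ∈ Icc (0 : ℝ) 1,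
      HasDerivWithinAt (fun t => F (p (y, t))) (y j * h (y, t)) (Icc 0 1) t := by
    intro t ht
    have h1 : HasDerivWithinAt (fun t => p (y, t)) (y j • EuclideanSpace.single j (1 : ℝ))
        (Icc 0 1) t := by
      have := ((hasDerivWithinAt_id t (Icc 0 1)).smul_const (y - zeroCoord j y)).const_add
        (zeroCoord j y)
      simpa only [p, id, one_smul, zeroCoord_apply, sub_sub_cancel] using this
    have h2 := ((hF.differentiableOn (by simp)) _ (hpC (y, t) ⟨hy, ht⟩)).hasFDerivWithinAt
    have h3 := h2.comp_hasDerivWithinAt t h1 fun t ht => hpC (y, t) ⟨hy, ht⟩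
    exact h3.congr_deriv (by simp [h])
  have hc : ContinuousOn (fun t => h (y, t)) (Icc 0 1) :=
    hh.continuousOn.comp (by fun_prop) fun t ht => ⟨hy, ht⟩
  have hint : IntervalIntegrable (fun t => y j * h (y, t)) MeasureTheory.volume 0 1 := by
    apply ContinuousOn.intervalIntegrable
    rw [uIcc_of_le zero_le_one]
    exact hc.const_mul _
  have := intervalIntegral.integral_eq_sub_of_hasDerivAt_of_le zero_le_one
    (fun t ht => (hd t ht).continuousWithinAt)
    (fun t ht => (hd t (Ioo_subset_Icc_self ht)).hasDerivAt (Icc_mem_nhds ht.1 ht.2)) hint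
  rw [intervalIntegral.integral_const_mul] at this
  simp only [p, one_smul, zero_smul, add_zero, add_sub_cancel,
    h0 _ (hCj y hy) (zeroCoord_apply_self j y), sub_zero] at this
  exact this.symm

/-- Hadamard's lemma on a relatively open subset of the quadrant: a smooth function that vanishes
on the face `yⱼ = 0` is smoothly divisible by `yⱼ`. -/
theorem exists_contDiffOn_eq_coord_mul {O : Set (EuclideanSpace ℝ (Fin n))} (hO : IsOpen O)
    (j : Fin n) {F : EuclideanSpace ℝ (Fin n) → ℝ}
    (hF : ContDiffOn ℝ ∞ F ({y | ∀ i, 0 ≤ y i} ∩ O))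
    (h0 : ∀ y ∈ {y | ∀ i, 0 ≤ y i} ∩ O, y j = 0 → F y = 0) :
    ∃ G : EuclideanSpace ℝ (Fin n) → ℝ, ContDiffOn ℝ ∞ G ({y | ∀ i, 0 ≤ y i} ∩ O) ∧
      ∀ y ∈ {y | ∀ i, 0 ≤ y i} ∩ O, F y = y j * G y := by
  set Q : Set (EuclideanSpace ℝ (Fin n)) := {y | ∀ i, 0 ≤ y i} with hQ
  -- on the face, continuity forces the quotient to be `∂ⱼF`
  let D : EuclideanSpace ℝ (Fin n) → ℝ := fun y =>
    fderivWithin ℝ F (Q ∩ O) y (EuclideanSpace.single j 1)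
  let G : EuclideanSpace ℝ (Fin n) → ℝ := fun y => if y j = 0 then D y else F y / y j
  have hFG : ∀ y ∈ Q ∩ O, F y = y j * G y := by
    intro y hy
    by_cases hyj : y j = 0
    · simp [hyj, h0 y hy hyj]
    · simp only [G, hyj, if_false]
      field_simp
  have hcj : ContDiff ℝ ∞ fun y : EuclideanSpace ℝ (Fin n) => y j := by fun_prop
  refine ⟨G, fun y hy => ?_, hFG⟩
  by_cases hyj : y j = 0
  · obtain ⟨r, hr, hrO⟩ := Metric.isOpen_iff.1 hO y hy.2
    let O' : Set (EuclideanSpace ℝ (Fin n)) :=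
      Metric.ball y r ∩ zeroCoord j ⁻¹' Metric.ball y r
    have hO' : IsOpen O' :=
      Metric.isOpen_ball.inter (Metric.isOpen_ball.preimage (zeroCoord j).continuous)
    have hO'O : O' ⊆ O := fun z hz => hrO hz.1
    have hQc : Convex ℝ Q := EuclideanQuadrant.convex
    have hC : Convex ℝ (Q ∩ O') := hQc.inter
      ((convex_ball y r).inter ((convex_ball y r).linear_preimage (zeroCoord j).toLinearMap))
    have hCj : ∀ z ∈ Q ∩ O', zeroCoord j z ∈ Q ∩ O' := fun z hz =>
      ⟨zeroCoord_nonneg j hz.1, hz.2.2, by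
        rw [mem_preimage, zeroCoord_eq_self (zeroCoord_apply_self j z)]
        exact hz.2.2⟩
    have hsub : Q ∩ O' ⊆ Q ∩ O := inter_subset_inter_right Q hO'O
    have hu : UniqueDiffOn ℝ (Q ∩ O') := uniqueDiffOn_quadrant_inter hO'
    obtain ⟨H, hH, hFH⟩ := exists_eq_mul_of_convex hC hu j hCj (hF.mono hsub)
      fun z hz => h0 z (hsub hz)
    have hyO' : y ∈ O' := ⟨Metric.mem_ball_self hr, by
      rw [mem_preimage, zeroCoord_eq_self hyj]
      exact Metric.mem_ball_self hr⟩
    have hGH : EqOn G H (Q ∩ O') := by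
      intro z hz
      by_cases hzj : z j = 0
      · have h1 : HasFDerivWithinAt F (fderivWithin ℝ F (Q ∩ O) z) (Q ∩ O') z :=
          ((hF.differentiableOn (by simp)) z (hsub hz)).hasFDerivWithinAt.mono hsub
        have h2 : HasFDerivWithinAt (fun w => w j * H w)
            (z j • fderivWithin ℝ H (Q ∩ O') z + H z • (EuclideanSpace.proj j)) (Q ∩ O') z :=
          (EuclideanSpace.proj (𝕜 := ℝ) j).hasFDerivWithinAt.mul
            ((hH.differentiableOn (by simp)) z hz).hasFDerivWithinAt
        have h3 := (hu z hz).eq h1 (h2.congr (fun w hw => hFH w hw) (hFH z hz))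
        simp only [G, hzj, if_true, D, h3]
        simp
      · simp only [G, hzj, if_false]
        rw [hFH z hz]
        field_simp
    refine ((hH.congr hGH) y ⟨hy.1, hyO'⟩).mono_of_mem_nhdsWithin ?_
    exact nhdsWithin_mono y inter_subset_left (inter_mem_nhdsWithin Q (hO'.mem_nhds hyO'))
  · have h1 : ContDiffWithinAt ℝ ∞ (fun y => F y / y j) (Q ∩ O) y :=
      (hF y hy).div hcj.contDiffWithinAt hyj
    refine h1.congr_of_eventuallyEq ?_ (by simp [G, hyj])
    have : ∀ᶠ z in 𝓝[Q ∩ O] y, z j ≠ 0 :=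
      (hcj.continuous.continuousAt.eventually_ne hyj).filter_mono nhdsWithin_le_nhds
    filter_upwards [this] with z hz
    simp [G, hz]

end Quadrant

/-! ### Manifolds with a single preferred chart -/

section SingleChart

variable {E H M : Type*} [NormedAddCommGroup E] [NormedSpace ℝ E] [TopologicalSpace H]
  {I : ModelWithCorners ℝ E H} [TopologicalSpace M] [ChartedSpace H M]
  {F : Type*} [NormedAddCommGroup F] [NormedSpace ℝ F]

theorem extChartAt_eq_of_chartAt_eq (hc : ∀ p q : M, chartAt H p = chartAt H q) (p q : M) :
    extChartAt I p = extChartAt I q := by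
  rw [extChartAt, extChartAt, hc p q]

theorem mem_extChartAt_source_of_chartAt_eq (hc : ∀ p q : M, chartAt H p = chartAt H q) (p q : M) :
    q ∈ (extChartAt I p).source := by
  rw [extChartAt_eq_of_chartAt_eq hc p q]
  exact mem_extChartAt_source q

/-- When there is a single preferred chart, the tangent bundle is literally the trivial bundle:
a vector field is smooth if and only if it is smooth as a function to the model space `E`. -/
theorem contMDiffOn_vectorField_iff [IsManifold I ∞ M]
    (hc : ∀ p q : M, chartAt H p = chartAt H q) {V : Π q : M, TangentSpace I q} {W : Set M} :
    ContMDiffOn I I.tangent ∞ (fun q => (⟨q, V q⟩ : TangentBundle I M)) W ↔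
      ContMDiffOn I 𝓘(ℝ, E) ∞ (fun q => (V q : E)) W := by
  refine forall₂_congr fun q hq => ?_
  refine Bundle.contMDiffWithinAt_section.trans ?_
  have : (fun x => (trivializationAt E (TangentSpace I) q ⟨x, V x⟩).2) = fun x => (V x : E) := by
    funext x
    rw [TangentBundle.trivializationAt_apply]
    change tangentCoordChange I x q x (V x) = V x
    have h : achart H x = achart H q := Subtype.ext (hc x q)
    rw [tangentCoordChange, h]
    exact tangentCoordChange_self (mem_extChartAt_source_of_chartAt_eq hc q x)
  rw [this]

theorem contMDiffOn_iff_comp_extChartAt_symm [IsManifold I ∞ M]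
    (hc : ∀ p q : M, chartAt H p = chartAt H q) (p : M) {f : M → F} {W : Set M} :
    ContMDiffOn I 𝓘(ℝ, F) ∞ f W ↔
      ContDiffOn ℝ ∞ (f ∘ (extChartAt I p).symm) (extChartAt I p '' W) :=
  contMDiffOn_iff_of_subset_source' (y := (0 : F))
    (fun q _ => mem_extChartAt_source_of_chartAt_eq hc p q)
    (fun _ _ => by rw [extChartAt_model_space_eq_id]; trivial)

/-- The image of an open set under the preferred chart is relatively open in the range of the
model. -/
theorem exists_isOpen_extChartAt_image (hc : ∀ p q : M, chartAt H p = chartAt H q) (p : M)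
    {W : Set M} (hW : IsOpen W) : ∃ O, IsOpen O ∧ extChartAt I p '' W = range I ∩ O := by
  have hWs : W ⊆ (chartAt H p).source := fun q _ => by
    simpa using mem_extChartAt_source_of_chartAt_eq (I := I) hc p q
  have h1 : IsOpen (chartAt H p '' W) := (chartAt H p).isOpen_image_of_subset_source hW hWs
  refine ⟨I.symm ⁻¹' (chartAt H p '' W), h1.preimage I.continuous_symm, ?_⟩
  rw [extChartAt_coe, image_comp, I.image_eq, inter_comm]

theorem hasMFDerivAt_iff_comp_extChartAt_symm (hc : ∀ p q : M, chartAt H p = chartAt H q) (p : M)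
    {f : M → F} {q : M} {f' : E →L[ℝ] F} :
    HasMFDerivAt I 𝓘(ℝ, F) f q f' ↔ ContinuousAt f q ∧
      HasFDerivWithinAt (f ∘ (extChartAt I p).symm) f' (range I) (extChartAt I p q) := by
  rw [extChartAt_eq_of_chartAt_eq hc p q]
  rfl

/-- The preferred chart has the identity as its derivative. -/
theorem hasMFDerivAt_extChartAt_self (hc : ∀ p q : M, chartAt H p = chartAt H q) (p q : M) :
    HasMFDerivAt I 𝓘(ℝ, E) (extChartAt I p) q (ContinuousLinearMap.id ℝ E) := by
  refine (hasMFDerivAt_iff_comp_extChartAt_symm hc p).2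
    ⟨continuousAt_extChartAt' (mem_extChartAt_source_of_chartAt_eq hc p q), ?_⟩
  have h : extChartAt I p q ∈ (extChartAt I p).target :=
    (extChartAt I p).map_source (mem_extChartAt_source_of_chartAt_eq hc p q)
  refine (hasFDerivWithinAt_id _ _).congr_of_eventuallyEq ?_ ?_
  · filter_upwards [extChartAt_target_mem_nhdsWithin_of_mem h] with y hy
    exact (extChartAt I p).right_inv hy
  · exact (extChartAt I p).right_inv h

theorem mfderivWithin_extChartAt_symm_self [IsManifold I ∞ M]
    (hc : ∀ p q : M, chartAt H p = chartAt H q) (p : M) {y : E} (hy : y ∈ (extChartAt I p).target) :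
    mfderivWithin 𝓘(ℝ, E) I (extChartAt I p).symm (range I) y = ContinuousLinearMap.id ℝ E := by
  have : IsManifold I 1 M := .of_le (n := ∞) (by simp)
  have h1 := mfderiv_extChartAt_comp_mfderivWithin_extChartAt_symm (I := I) hy
  rw [(hasMFDerivAt_extChartAt_self hc p _).mfderiv] at h1
  exact h1

theorem mlieBracket_eq_of_chartAt_eq [IsManifold I ∞ M]
    (hc : ∀ p q : M, chartAt H p = chartAt H q) {V V' : Π q : M, TangentSpace I q} {q : M}
    {A A' : E →L[ℝ] E} (hV : HasMFDerivAt I 𝓘(ℝ, E) (fun x => (V x : E)) q A)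
    (hV' : HasMFDerivAt I 𝓘(ℝ, E) (fun x => (V' x : E)) q A') :
    VectorField.mlieBracket I V V' q = A' (V q) - A (V' q) := by
  have hinv : (ContinuousLinearMap.id ℝ E).inverse = ContinuousLinearMap.id ℝ E :=
    ContinuousLinearMap.inverse_id
  have pull (Z : Π q : M, TangentSpace I q) :
      (VectorField.mpullbackWithin 𝓘(ℝ, E) I (extChartAt I q).symm Z (range I) : E → E)
        =ᶠ[𝓝[range I] (extChartAt I q q)] (fun x => (Z x : E)) ∘ (extChartAt I q).symm := by
    filter_upwards [extChartAt_target_mem_nhdsWithin (I := I) q] with y hy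
    rw [VectorField.mpullbackWithin_apply, mfderivWithin_extChartAt_symm_self hc q hy]
    exact DFunLike.congr_fun hinv _
  rw [← VectorField.mlieBracketWithin_univ, VectorField.mlieBracketWithin_apply,
    (hasMFDerivAt_extChartAt_self hc q q).mfderiv, preimage_univ, univ_inter]
  have hqr : extChartAt I q q ∈ range I := mem_range_self _
  have hu : UniqueDiffWithinAt ℝ (range I) (extChartAt I q q) := I.uniqueDiffOn _ hqr
  have e1 := ((hasMFDerivAt_iff_comp_extChartAt_symm hc q).1 hV).2.fderivWithin hu
  have e2 := ((hasMFDerivAt_iff_comp_extChartAt_symm hc q).1 hV').2.fderivWithin hu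
  have e3 := Filter.EventuallyEq.lieBracketWithin_vectorField_eq_of_mem (𝕜 := ℝ) (pull V) (pull V')
    hqr
  refine (DFunLike.congr_fun hinv _).trans ?_
  refine e3.trans ?_
  rw [VectorField.lieBracketWithin, e1, e2]
  change A' (V ((extChartAt I q).symm (extChartAt I q q))) -
    A (V' ((extChartAt I q).symm (extChartAt I q q))) = _
  rw [extChartAt_to_inv]

/-- The derivative of a smooth function along a smooth vector field is smooth. -/
theorem contMDiffOn_mfderiv_apply [IsManifold I ∞ M] (hc : ∀ p q : M, chartAt H p = chartAt H q)
    {W : Set M} (hW : IsOpen W) {f : M → F} (hf : ContMDiffOn I 𝓘(ℝ, F) ∞ f W)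
    {V : Π q : M, TangentSpace I q} (hV : ContMDiffOn I 𝓘(ℝ, E) ∞ (fun q => (V q : E)) W) :
    ContMDiffOn I 𝓘(ℝ, F) ∞ (fun q => (mfderiv I 𝓘(ℝ, F) f q (V q) : F)) W := by
  intro p hp
  suffices h : ContMDiffOn I 𝓘(ℝ, F) ∞ (fun q => (mfderiv I 𝓘(ℝ, F) f q (V q) : F)) W from h p hp
  have hVp := (contMDiffOn_iff_comp_extChartAt_symm hc p).1 hV
  have hfp := (contMDiffOn_iff_comp_extChartAt_symm hc p).1 hf
  refine (contMDiffOn_iff_comp_extChartAt_symm hc p).2 ?_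
  obtain ⟨O, hO, hOW⟩ := exists_isOpen_extChartAt_image (I := I) hc p hW
  have hu : UniqueDiffOn ℝ (extChartAt I p '' W) := hOW ▸ I.uniqueDiffOn.inter hO
  refine ((hfp.fderivWithin hu (m := ∞) (by simp)).clm_apply hVp).congr ?_
  rintro _ ⟨q, hq, rfl⟩
  have hs := mem_extChartAt_source_of_chartAt_eq (I := I) hc p q
  have hdf : MDifferentiableAt I 𝓘(ℝ, F) f q :=
    (hf.contMDiffAt (hW.mem_nhds hq)).mdifferentiableAt (by simp)
  have h1 := ((hasMFDerivAt_iff_comp_extChartAt_symm hc p).1 hdf.hasMFDerivAt).2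
  have h2 : fderivWithin ℝ (f ∘ (extChartAt I p).symm) (extChartAt I p '' W) (extChartAt I p q) =
      mfderiv I 𝓘(ℝ, F) f q :=
    (h1.mono (hOW ▸ inter_subset_left)).fderivWithin (hu _ (mem_image_of_mem _ hq))
  change (mfderiv I 𝓘(ℝ, F) f ((extChartAt I p).symm (extChartAt I p q))
      (V ((extChartAt I p).symm (extChartAt I p q))) : F) =
    fderivWithin ℝ (f ∘ (extChartAt I p).symm) (extChartAt I p '' W) (extChartAt I p q)
      (V ((extChartAt I p).symm (extChartAt I p q)))
  rw [h2, (extChartAt I p).left_inv hs]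
  rfl

end SingleChart

/-! ### Coordinates adapted to a divisor -/

section AdaptedChart

variable {n : ℕ} {M : Type*} [TopologicalSpace M] [ChartedSpace (EuclideanQuadrant n) M]

/-- The coordinates of a point of `M`, in the preferred chart at this point. -/
noncomputable def quadrantCoords (n : ℕ) {M : Type*} [TopologicalSpace M]
    [ChartedSpace (EuclideanQuadrant n) M] (q : M) : EuclideanSpace ℝ (Fin n) :=
  extChartAt (𝓠 n) q q

/-- The preferred chart of `M` is global, the hypersurfaces `D i` are distinct coordinate
hyperplanes of it, and the coordinates that do not define one of them are positive. -/
structure IsAdaptedChart {ι : Type*} (D : ι → Set M) (idx : ι → Fin n) : Prop where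
  chartAt_eq : ∀ p q : M, chartAt (EuclideanQuadrant n) p = chartAt (EuclideanQuadrant n) q
  idx_injective : Function.Injective idx
  mem_iff : ∀ i q, q ∈ D i ↔ quadrantCoords n q (idx i) = 0
  pos : ∀ j, j ∉ range idx → ∀ q : M, 0 < quadrantCoords n q j

theorem quadrantCoords_nonneg (q : M) (j : Fin n) : 0 ≤ quadrantCoords n q j :=
  (chartAt (EuclideanQuadrant n) q q).2 j

namespace IsAdaptedChart

variable {ι : Type*} {D : ι → Set M} {idx : ι → Fin n} (A : IsAdaptedChart D idx)

include A

theorem extChartAt_apply (p q : M) : extChartAt (𝓠 n) p q = quadrantCoords n q := by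
  rw [quadrantCoords, extChartAt_eq_of_chartAt_eq A.chartAt_eq p q]

theorem mem_source (p q : M) : q ∈ (chartAt (EuclideanQuadrant n) p).source := by
  rw [A.chartAt_eq p q]
  exact mem_chart_source _ q

theorem hasMFDerivAt_coords (q : M) :
    HasMFDerivAt (𝓠 n) 𝓘(ℝ, EuclideanSpace ℝ (Fin n)) (quadrantCoords (M := M) n) q
      (ContinuousLinearMap.id ℝ (EuclideanSpace ℝ (Fin n))) := by
  have h : quadrantCoords (M := M) n = extChartAt (𝓠 n) q :=
    funext fun x => (A.extChartAt_apply q x).symm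
  rw [h]
  exact hasMFDerivAt_extChartAt_self A.chartAt_eq q q

theorem hasMFDerivAt_coord (q : M) (j : Fin n) :
    HasMFDerivAt (𝓠 n) 𝓘(ℝ, ℝ) (fun x : M => quadrantCoords n x j) q
      (EuclideanSpace.proj j : EuclideanSpace ℝ (Fin n) →L[ℝ] ℝ) :=
  (EuclideanSpace.proj (𝕜 := ℝ) j).hasMFDerivAt.comp q (A.hasMFDerivAt_coords q)

theorem contMDiff_coords [IsManifold (𝓠 n) ∞ M] :
    ContMDiff (𝓠 n) 𝓘(ℝ, EuclideanSpace ℝ (Fin n)) ∞ (quadrantCoords (M := M) n) := by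
  intro q
  have h : quadrantCoords (M := M) n = extChartAt (𝓠 n) q :=
    funext fun x => (A.extChartAt_apply q x).symm
  rw [h]
  exact contMDiffAt_extChartAt

theorem contMDiff_coord [IsManifold (𝓠 n) ∞ M] (j : Fin n) :
    ContMDiff (𝓠 n) 𝓘(ℝ, ℝ) ∞ (fun x : M => quadrantCoords n x j) :=
  (EuclideanSpace.proj (𝕜 := ℝ) j).contMDiff.comp A.contMDiff_coords

theorem isInducing_coords : IsInducing (quadrantCoords (M := M) n) := by
  rcases isEmpty_or_nonempty M with hM | ⟨⟨p⟩⟩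
  · exact ⟨Subsingleton.elim _ _⟩
  have h : quadrantCoords (M := M) n = Subtype.val ∘ chartAt (EuclideanQuadrant n) p :=
    funext fun x => (A.extChartAt_apply p x).symm
  rw [h]
  exact IsInducing.subtypeVal.comp ((chartAt (EuclideanQuadrant n) p).isOpenEmbedding
    (eq_univ_of_forall (A.mem_source p))).isInducing

/-- A map to `M` is smooth if its coordinates are. -/
theorem contMDiff_of_coords [IsManifold (𝓠 n) ∞ M] {E' H' N : Type*} [NormedAddCommGroup E']
    [NormedSpace ℝ E'] [TopologicalSpace H'] {I' : ModelWithCorners ℝ E' H'} [TopologicalSpace N]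
    [ChartedSpace H' N] [IsManifold I' ∞ N] {f : N → M}
    (hf : ContMDiff I' 𝓘(ℝ, EuclideanSpace ℝ (Fin n)) ∞ fun x => quadrantCoords n (f x)) :
    ContMDiff I' (𝓠 n) ∞ f := by
  refine contMDiff_iff_target.2 ⟨A.isInducing_coords.continuous_iff.2 hf.continuous, fun p => ?_⟩
  exact hf.contMDiffOn.congr fun x _ => A.extChartAt_apply p (f x)

theorem isClosed (i : ι) : IsClosed (D i) := by
  have : D i = {q | quadrantCoords n q (idx i) = 0} := Set.ext (A.mem_iff i)
  rw [this]
  exact isClosed_eq ((EuclideanSpace.proj (𝕜 := ℝ) (idx i)).continuous.comp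
    A.isInducing_coords.continuous) continuous_const

/-- The points off all coordinate hyperplanes are dense. -/
theorem dense_pos : Dense {q : M | ∀ j, 0 < quadrantCoords n q j} := by
  rcases isEmpty_or_nonempty M with hM | ⟨⟨p⟩⟩
  · exact fun q => (hM.false q).elim
  have hd : Dense {z : EuclideanQuadrant n | ∀ j, 0 < z.1 j} := by
    intro z
    have hc : Continuous fun t : ℝ => (⟨WithLp.toLp 2 fun j => z.1 j + |t|, fun j =>
        add_nonneg (z.2 j) (abs_nonneg t)⟩ : EuclideanQuadrant n) :=
      Continuous.subtype_mk (by fun_prop) _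
    have h0 := hc.tendsto 0
    have hz : (⟨WithLp.toLp 2 fun j => z.1 j + |(0 : ℝ)|, fun j =>
        add_nonneg (z.2 j) (abs_nonneg 0)⟩ : EuclideanQuadrant n) = z :=
      EuclideanQuadrant.ext _ _ (by ext j; simp)
    rw [hz] at h0
    refine mem_closure_of_tendsto (h0.mono_left (nhdsWithin_le_nhds (s := Ioi 0))) ?_
    filter_upwards [self_mem_nhdsWithin] with t ht j
    exact add_pos_of_nonneg_of_pos (z.2 j) (abs_pos.2 (ne_of_gt ht))
  have he : IsOpenEmbedding (chartAt (EuclideanQuadrant n) p) :=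
    (chartAt (EuclideanQuadrant n) p).isOpenEmbedding (eq_univ_of_forall (A.mem_source p))
  convert hd.preimage he.isOpenMap using 1
  ext q
  exact forall_congr' fun j => by rw [← A.extChartAt_apply p q]; rfl

/-- Hadamard's lemma: a smooth function that vanishes where the `j`-th coordinate does is smoothly
divisible by this coordinate. -/
theorem exists_eq_coord_mul [IsManifold (𝓠 n) ∞ M] {W : Set M} (hW : IsOpen W) (j : Fin n)
    {f : M → ℝ} (hf : ContMDiffOn (𝓠 n) 𝓘(ℝ, ℝ) ∞ f W)
    (h0 : ∀ q ∈ W, quadrantCoords n q j = 0 → f q = 0) :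
    ∃ g : M → ℝ, ContMDiffOn (𝓠 n) 𝓘(ℝ, ℝ) ∞ g W ∧ ∀ q ∈ W, f q = quadrantCoords n q j * g q := by
  rcases isEmpty_or_nonempty M with hM | ⟨⟨p⟩⟩
  · exact ⟨f, hf, fun q => (hM.false q).elim⟩
  obtain ⟨O, hO, hOW⟩ := exists_isOpen_extChartAt_image (I := 𝓠 n) A.chartAt_eq p hW
  rw [show range (𝓠 n) = _ from range_euclideanQuadrant n] at hOW
  have hf' := (contMDiffOn_iff_comp_extChartAt_symm A.chartAt_eq p).1 hf
  rw [hOW] at hf'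
  have hinv (q : M) : (extChartAt (𝓠 n) p).symm (extChartAt (𝓠 n) p q) = q :=
    (extChartAt (𝓠 n) p).left_inv (mem_extChartAt_source_of_chartAt_eq A.chartAt_eq p q)
  obtain ⟨G, hG, hfG⟩ := exists_contDiffOn_eq_coord_mul hO j hf' (by
    rw [← hOW]
    rintro _ ⟨q, hq, rfl⟩ hqj
    rw [Function.comp_apply, hinv]
    exact h0 q hq (by rwa [A.extChartAt_apply] at hqj))
  rw [← hOW] at hG hfG
  refine ⟨G ∘ extChartAt (𝓠 n) p, ?_, fun q hq => ?_⟩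
  · refine (contMDiffOn_iff_comp_extChartAt_symm A.chartAt_eq p).2 (hG.congr ?_)
    rintro _ ⟨q, hq, rfl⟩
    simp only [Function.comp_apply, hinv]
  · have := hfG _ (mem_image_of_mem _ hq)
    rw [Function.comp_apply, hinv] at this
    rw [this, Function.comp_apply, A.extChartAt_apply]

theorem isTangentTo_iff [IsManifold (𝓠 n) ∞ M] {i : ι} {q : M} (hq : q ∈ D i)
    (v : EuclideanSpace ℝ (Fin n)) : IsTangentTo (D i) q v ↔ v (idx i) = 0 := by
  constructor
  · intro h
    have := h (fun x => quadrantCoords n x (idx i)) (A.contMDiff_coord (idx i) q)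
      (eventually_nhdsWithin_of_forall fun y hy => (A.mem_iff i y).1 hy)
    rw [(A.hasMFDerivAt_coord q (idx i)).mfderiv] at this
    exact this
  · intro hv f hf hf0
    have hinv : (extChartAt (𝓠 n) q).symm (extChartAt (𝓠 n) q q) = q := extChartAt_to_inv q
    set y : EuclideanSpace ℝ (Fin n) := extChartAt (𝓠 n) q q with hy
    have hd := ((hasMFDerivAt_iff_comp_extChartAt_symm A.chartAt_eq q).1
      (hf.mdifferentiableAt (by simp)).hasMFDerivAt).2
    set f' : EuclideanSpace ℝ (Fin n) →L[ℝ] ℝ := mfderiv (𝓠 n) 𝓘(ℝ, ℝ) f q with hf'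
    rw [show range (𝓠 n) = _ from range_euclideanQuadrant n] at hd
    -- the derivative vanishes along each coordinate ray contained in the face
    have hl : ∀ l, l ≠ idx i → f' (EuclideanSpace.single l 1) = 0 := by
      intro l hl
      let c : ℝ → EuclideanSpace ℝ (Fin n) := fun t => y + t • EuclideanSpace.single l (1 : ℝ)
      have hc0 : c 0 = y := by simp [c]
      have hcd : HasDerivWithinAt c (EuclideanSpace.single l (1 : ℝ)) (Ici 0) 0 := by
        have := ((hasDerivWithinAt_id (0 : ℝ) (Ici 0)).smul_const
          (EuclideanSpace.single l (1 : ℝ))).const_add y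
        simpa only [id, one_smul] using this
      have hcQ : MapsTo c (Ici 0) {y | ∀ i, 0 ≤ y i} := by
        intro t ht m
        have hm : 0 ≤ y m := quadrantCoords_nonneg q m
        have h2 : 0 ≤ (EuclideanSpace.single l (1 : ℝ)) m := by
          rw [PiLp.single_apply]; split_ifs <;> simp
        exact add_nonneg hm (mul_nonneg ht h2)
      have h1 := HasFDerivWithinAt.comp_hasDerivWithinAt (0 : ℝ) (by rw [hc0]; exact hd) hcd hcQ
      have hct : Filter.Tendsto (fun t => (extChartAt (𝓠 n) q).symm (c t)) (𝓝[≥] 0)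
          (𝓝[D i] q) := by
        have hcy : Filter.Tendsto c (𝓝[≥] 0) (𝓝[range (𝓠 n)] y) := by
          rw [show range (𝓠 n) = _ from range_euclideanQuadrant n]
          exact hc0 ▸ hcd.continuousWithinAt.tendsto_nhdsWithin hcQ
        have h3 : Filter.Tendsto (fun t => (extChartAt (𝓠 n) q).symm (c t)) (𝓝[≥] 0) (𝓝 q) := by
          have := (continuousAt_extChartAt_symm (I := 𝓠 n) q).tendsto
          rw [hinv] at this
          exact this.comp (hcy.mono_right nhdsWithin_le_nhds)
        refine tendsto_nhdsWithin_iff.2 ⟨h3, ?_⟩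
        filter_upwards [hcy.eventually (extChartAt_target_mem_nhdsWithin (I := 𝓠 n) q)] with t ht
        rw [A.mem_iff, ← A.extChartAt_apply q, (extChartAt (𝓠 n) q).right_inv ht]
        have : y (idx i) = 0 := (A.mem_iff i q).1 hq
        simp [c, this, hl.symm]
      have h2 : HasDerivWithinAt ((f ∘ (extChartAt (𝓠 n) q).symm) ∘ c) 0 (Ici 0) 0 := by
        refine (hasDerivWithinAt_const (0 : ℝ) (Ici (0 : ℝ)) (0 : ℝ)).congr_of_eventuallyEq
          (hct.eventually hf0) ?_
        simp only [Function.comp_apply, hc0, hinv]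
        exact hf0.self_of_nhdsWithin hq
      exact (uniqueDiffWithinAt_Ici 0).eq_deriv _ h1 h2
    have hsum : v = ∑ l, v l • EuclideanSpace.single l (1 : ℝ) := by
      ext m
      simp [Pi.single_apply]
    change f' v = 0
    rw [hsum, map_sum]
    refine Finset.sum_eq_zero fun l _ => ?_
    rw [map_smul]
    rcases eq_or_ne l (idx i) with rfl | h
    · rw [hv, zero_smul]
    · rw [hl l h, smul_zero]

end IsAdaptedChart
end AdaptedChart

/-! ### The log affine structure of an adapted chart -/

section ScalingField

variable {n : ℕ} {U : Type*} [NormedAddCommGroup U] [NormedSpace ℝ U] [FiniteDimensional ℝ U]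

/-- The bilinear map `(u, y) ↦ ∑ⱼ uⱼ yⱼ eⱼ`, where `uⱼ` are the coordinates of `u` in the
basis `b`. -/
noncomputable def diagonalScaling (b : Module.Basis (Fin n) ℝ U) :
    U →L[ℝ] EuclideanSpace ℝ (Fin n) →L[ℝ] EuclideanSpace ℝ (Fin n) :=
  ∑ j, (LinearMap.toContinuousLinearMap (b.coord j)).smulRight
    ((EuclideanSpace.proj j : EuclideanSpace ℝ (Fin n) →L[ℝ] ℝ).smulRight
      (EuclideanSpace.single j (1 : ℝ)))

theorem diagonalScaling_apply (b : Module.Basis (Fin n) ℝ U) (u : U)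
    (y : EuclideanSpace ℝ (Fin n)) (j : Fin n) :
    diagonalScaling b u y j = b.coord j u * y j := by
  simp [diagonalScaling, Pi.single_apply]

variable (M : Type*) [TopologicalSpace M] [ChartedSpace (EuclideanQuadrant n) M]

/-- The infinitesimal action `u ↦ ∑ⱼ uⱼ yⱼ ∂ⱼ` in the preferred coordinates `yⱼ`. -/
noncomputable def scalingField (b : Module.Basis (Fin n) ℝ U) :
    U →ₗ[ℝ] Π q : M, TangentSpace (𝓠 n) q where
  toFun u q := diagonalScaling b u (quadrantCoords n q)
  map_add' u v := by
    funext q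
    exact congrArg (fun B : EuclideanSpace ℝ (Fin n) →L[ℝ] _ => B (quadrantCoords n q))
      ((diagonalScaling b).map_add u v)
  map_smul' c u := by
    funext q
    exact congrArg (fun B : EuclideanSpace ℝ (Fin n) →L[ℝ] _ => B (quadrantCoords n q))
      ((diagonalScaling b).map_smul c u)

variable {M}

theorem scalingField_apply (b : Module.Basis (Fin n) ℝ U) (u : U) (q : M) :
    scalingField M b u q = diagonalScaling b u (quadrantCoords n q) := rfl

open Classical in
/-- The logarithmic form of the scaling action, on sections over `W`: a vector field of the form
`q ↦ scalingField M b (a q) q` on `W`, with `a` smooth, is sent to `a`. Any such `a` is taken; it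
is unique on `W`, see `IsAdaptedChart.eqOn_of_scalingField_eq`. -/
noncomputable def scalingForm (b : Module.Basis (Fin n) ℝ U) (W : Set M)
    (V : Π q : M, TangentSpace (𝓠 n) q) : M → U :=
  if h : ∃ a : M → U, ContMDiffOn (𝓠 n) 𝓘(ℝ, U) ∞ a W ∧ ∀ q ∈ W, scalingField M b (a q) q = V q
  then h.choose else 0

end ScalingField

namespace IsAdaptedChart

variable {n : ℕ} {M : Type*} [TopologicalSpace M] [ChartedSpace (EuclideanQuadrant n) M]
  {ι : Type*} {D : ι → Set M} {idx : ι → Fin n} (A : IsAdaptedChart D idx)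
  {U : Type*} [NormedAddCommGroup U] [NormedSpace ℝ U] (b : Module.Basis (Fin n) ℝ U)

theorem contMDiffOn_sum_smul_basis {W : Set M} {g : Fin n → M → ℝ}
    (hg : ∀ j, ContMDiffOn (𝓠 n) 𝓘(ℝ, ℝ) ∞ (g j) W) :
    ContMDiffOn (𝓠 n) 𝓘(ℝ, U) ∞ (fun q => ∑ j, g j q • b j) W :=
  contMDiffOn_finsetSum fun j _ => (hg j).smul contMDiffOn_const

variable [FiniteDimensional ℝ U]

include A

/-- The coefficients of a vector field in terms of the scaling fields are unique: this is clear at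
points with positive coordinates, which are dense. -/
theorem eqOn_of_scalingField_eq {W : Set M} (hW : IsOpen W) {a a' : M → U} (ha : ContinuousOn a W)
    (ha' : ContinuousOn a' W)
    (h : ∀ q ∈ W, scalingField M b (a q) q = scalingField M b (a' q) q) : EqOn a a' W := by
  refine EqOn.of_subset_closure (s := W ∩ {q : M | ∀ j, 0 < quadrantCoords n q j}) ?_ ha ha'
    inter_subset_left (A.dense_pos.open_subset_closure_inter hW)
  intro q hq
  refine b.ext_elem fun j => ?_
  have h1 : diagonalScaling b (a q) (quadrantCoords n q) =
    diagonalScaling b (a' q) (quadrantCoords n q) := h q hq.1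
  have h2 := congrArg (fun y : EuclideanSpace ℝ (Fin n) => y j) h1
  simp only [diagonalScaling_apply] at h2
  exact mul_right_cancel₀ (hq.2 j).ne' h2

theorem hasMFDerivAt_scalingField {a : M → U} {q : M} {a' : EuclideanSpace ℝ (Fin n) →L[ℝ] U}
    (ha : HasMFDerivAt (𝓠 n) 𝓘(ℝ, U) a q a') :
    HasMFDerivAt (𝓠 n) 𝓘(ℝ, EuclideanSpace ℝ (Fin n))
      (fun q => diagonalScaling b (a q) (quadrantCoords n q)) q
      (diagonalScaling b (a q) + ((diagonalScaling b).comp a').flip (quadrantCoords n q)) := by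
  have h1 := ((hasMFDerivAt_iff_comp_extChartAt_symm A.chartAt_eq q).1 ha).2
  have h2 := ((hasMFDerivAt_iff_comp_extChartAt_symm A.chartAt_eq q).1 (A.hasMFDerivAt_coords q)).2
  refine (hasMFDerivAt_iff_comp_extChartAt_symm A.chartAt_eq q).2
    ⟨((diagonalScaling b).continuous.continuousAt.comp ha.1).clm_apply
      (A.hasMFDerivAt_coords q).1, ?_⟩
  have h3 := ((diagonalScaling b).hasFDerivAt.comp_hasFDerivWithinAt _ h1).clm_apply h2
  simp only [Function.comp_apply, extChartAt_to_inv, ContinuousLinearMap.comp_id] at h3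
  exact h3

theorem scalingForm_eqOn {W : Set M} (hW : IsOpen W) {V : Π q : M, TangentSpace (𝓠 n) q}
    {a : M → U} (ha : ContMDiffOn (𝓠 n) 𝓘(ℝ, U) ∞ a W)
    (h : ∀ q ∈ W, scalingField M b (a q) q = V q) : EqOn (scalingForm b W V) a W := by
  have h' : ∃ a : M → U, ContMDiffOn (𝓠 n) 𝓘(ℝ, U) ∞ a W ∧
    ∀ q ∈ W, scalingField M b (a q) q = V q := ⟨a, ha, h⟩
  rw [scalingForm, dif_pos h']
  exact A.eqOn_of_scalingField_eq b hW h'.choose_spec.1.continuousOn ha.continuousOn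
    fun q hq => (h'.choose_spec.2 q hq).trans (h q hq).symm

variable [IsManifold (𝓠 n) ∞ M]

theorem contMDiffOn_scalingField {W : Set M} {a : M → U}
    (ha : ContMDiffOn (𝓠 n) 𝓘(ℝ, U) ∞ a W) :
    ContMDiffOn (𝓠 n) 𝓘(ℝ, EuclideanSpace ℝ (Fin n)) ∞
      (fun q => diagonalScaling b (a q) (quadrantCoords n q)) W :=
  (((diagonalScaling b).contMDiff (n := ∞)).comp_contMDiffOn ha).clm_apply
    A.contMDiff_coords.contMDiffOn

theorem isLogVectorField_scalingField {W : Set M} {a : M → U}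
    (ha : ContMDiffOn (𝓠 n) 𝓘(ℝ, U) ∞ a W) :
    IsLogVectorField D W fun q => scalingField M b (a q) q := by
  refine ⟨(contMDiffOn_vectorField_iff A.chartAt_eq).2 (A.contMDiffOn_scalingField b ha),
    fun i q hq => (A.isTangentTo_iff hq.2 _).2 ?_⟩
  change diagonalScaling b (a q) (quadrantCoords n q) (idx i) = 0
  rw [diagonalScaling_apply, (A.mem_iff i q).1 hq.2, mul_zero]

/-- The `j`-th component of a smooth vector field is smoothly divisible by the `j`-th coordinate if
the field is tangent to the hypersurface `D i` with `idx i = j`. If there is no such `i`, then the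
coordinate has no zeros. -/
theorem exists_component_eq_coord_mul {W : Set M} (hW : IsOpen W)
    {V : M → EuclideanSpace ℝ (Fin n)}
    (hV : ContMDiffOn (𝓠 n) 𝓘(ℝ, EuclideanSpace ℝ (Fin n)) ∞ V W) (j : Fin n)
    (ht : ∀ i, idx i = j → ∀ q ∈ W ∩ D i, IsTangentTo (D i) q (V q)) :
    ∃ g : M → ℝ, ContMDiffOn (𝓠 n) 𝓘(ℝ, ℝ) ∞ g W ∧
      ∀ q ∈ W, V q j = quadrantCoords n q j * g q := by
  refine A.exists_eq_coord_mul hW j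
    (((EuclideanSpace.proj (𝕜 := ℝ) j).contMDiff (n := ∞)).comp_contMDiffOn hV) fun q hq hqj => ?_
  by_cases hj : j ∈ range idx
  · obtain ⟨i, rfl⟩ := hj
    have hqi := (A.mem_iff i q).2 hqj
    exact (A.isTangentTo_iff hqi (V q)).1 (ht i rfl q ⟨hq, hqi⟩)
  · exact absurd hqj (A.pos j hj q).ne'

/-- A logarithmic vector field is a combination of the scaling fields with smooth coefficients. -/
theorem exists_eq_scalingField {W : Set M} (hW : IsOpen W) {V : Π q : M, TangentSpace (𝓠 n) q}
    (hV : IsLogVectorField D W V) :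
    ∃ a : M → U, ContMDiffOn (𝓠 n) 𝓘(ℝ, U) ∞ a W ∧ ∀ q ∈ W, scalingField M b (a q) q = V q := by
  have hV' := (contMDiffOn_vectorField_iff A.chartAt_eq).1 hV.1
  choose g hg hVg using fun j => A.exists_component_eq_coord_mul hW hV' j fun i _ => hV.2 i
  refine ⟨_, contMDiffOn_sum_smul_basis b hg, fun q hq => ?_⟩
  refine PiLp.ext fun j => ?_
  rw [scalingField_apply, diagonalScaling_apply]
  have : b.coord j (∑ j, g j q • b j) = g j q := by simp [Finsupp.single_apply]
  rw [this, mul_comm]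
  exact (hVg j q hq).symm

theorem scalingForm_spec {W : Set M} (hW : IsOpen W) {V : Π q : M, TangentSpace (𝓠 n) q}
    (hV : IsLogVectorField D W V) :
    ContMDiffOn (𝓠 n) 𝓘(ℝ, U) ∞ (scalingForm b W V) W ∧
      ∀ q ∈ W, scalingField M b (scalingForm b W V q) q = V q := by
  have h := A.exists_eq_scalingField b hW hV
  rw [scalingForm, dif_pos h]
  exact h.choose_spec

/-- The bracket of `∑ⱼ aⱼ yⱼ ∂ⱼ` and `∑ⱼ a'ⱼ yⱼ ∂ⱼ`: the terms with derivatives of the coordinates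
`yⱼ` cancel. -/
theorem mlieBracket_scalingField {W : Set M} (hW : IsOpen W) {V V' : Π q : M, TangentSpace (𝓠 n) q}
    {a a' : M → U} (ha : ContMDiffOn (𝓠 n) 𝓘(ℝ, U) ∞ a W)
    (ha' : ContMDiffOn (𝓠 n) 𝓘(ℝ, U) ∞ a' W) (h : ∀ q ∈ W, scalingField M b (a q) q = V q)
    (h' : ∀ q ∈ W, scalingField M b (a' q) q = V' q) {q : M} (hq : q ∈ W) :
    VectorField.mlieBracket (𝓠 n) V V' q =
      scalingField M b (derivAlong a' q (V q) - derivAlong a q (V' q)) q := by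
  have key {a : M → U} (ha : ContMDiffOn (𝓠 n) 𝓘(ℝ, U) ∞ a W) {V : Π q : M, TangentSpace (𝓠 n) q}
      (h : ∀ q ∈ W, scalingField M b (a q) q = V q) :=
    (A.hasMFDerivAt_scalingField b (((ha.contMDiffAt (hW.mem_nhds hq)).mdifferentiableAt
      (by simp)).hasMFDerivAt)).congr_of_eventuallyEq
      (f₁ := fun q => (V q : EuclideanSpace ℝ (Fin n)))
      (by filter_upwards [hW.mem_nhds hq] with x hx using (h x hx).symm)
  rw [mlieBracket_eq_of_chartAt_eq A.chartAt_eq (key ha h) (key ha' h')]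
  let v : EuclideanSpace ℝ (Fin n) := V q
  let v' : EuclideanSpace ℝ (Fin n) := V' q
  have e1 (j : Fin n) : v j = b.coord j (a q) * quadrantCoords n q j :=
    (congrArg (fun y : EuclideanSpace ℝ (Fin n) => y j) (h q hq).symm).trans
      (diagonalScaling_apply b _ _ j)
  have e2 (j : Fin n) : v' j = b.coord j (a' q) * quadrantCoords n q j :=
    (congrArg (fun y : EuclideanSpace ℝ (Fin n) => y j) (h' q hq).symm).trans
      (diagonalScaling_apply b _ _ j)
  refine PiLp.ext fun j => ?_
  change (diagonalScaling b (a' q) v j +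
      diagonalScaling b (derivAlong a' q v) (quadrantCoords n q) j) -
    (diagonalScaling b (a q) v' j +
      diagonalScaling b (derivAlong a q v') (quadrantCoords n q) j) =
    diagonalScaling b (derivAlong a' q v - derivAlong a q v') (quadrantCoords n q) j
  rw [diagonalScaling_apply, diagonalScaling_apply, diagonalScaling_apply, diagonalScaling_apply,
    diagonalScaling_apply, LinearMap.map_sub, e1, e2]
  ring

theorem isFreeDivisor [Finite ι] : IsFreeDivisor n D where
  hypersurface i := ⟨A.isClosed i, fun p hp => ⟨chartAt _ p,
    IsManifold.chart_mem_maximalAtlas p, mem_chart_source _ p, idx i, fun q _ => by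
      rw [A.mem_iff]
      change _ ↔ extChartAt (𝓠 n) p q (idx i) = extChartAt (𝓠 n) p p (idx i)
      rw [A.extChartAt_apply, A.extChartAt_apply, (A.mem_iff i p).1 hp]⟩⟩
  locallyFinite := locallyFinite_of_finite D
  locallyFree p := by
    -- the coordinate basis of `ℝⁿ` serves as the basis `b`
    let b : Module.Basis (Fin n) ℝ (EuclideanSpace ℝ (Fin n)) :=
      (EuclideanSpace.basisFun (Fin n) ℝ).toBasis
    have hE (c : Fin n → M → ℝ) (q : M) :
        ∑ j, c j q • scalingField M b (b j) q = scalingField M b (∑ j, c j q • b j) q := by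
      simp only [map_sum, map_smul, Finset.sum_apply, Pi.smul_apply]
    refine ⟨univ, isOpen_univ, mem_univ p, fun j => scalingField M b (b j), fun j =>
      A.isLogVectorField_scalingField b contMDiffOn_const, fun W _ hW V hV => ⟨?_, ?_⟩⟩
    · obtain ⟨a, ha, haV⟩ := A.exists_eq_scalingField b hW hV
      refine ⟨fun j q => b.coord j (a q), fun j =>
        ((LinearMap.toContinuousLinearMap (b.coord j)).contMDiff (n := ∞)).comp_contMDiffOn ha,
        fun q hq => ?_⟩
      have := hE (fun j q => b.coord j (a q)) q
      simp only [Module.Basis.coord_apply, b.sum_repr] at this ⊢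
      rw [this, haV q hq]
    · intro c c' hc hc' h h' j q hq
      have := A.eqOn_of_scalingField_eq b hW (contMDiffOn_sum_smul_basis b hc).continuousOn
        (contMDiffOn_sum_smul_basis b hc').continuousOn
        (fun q hq => by rw [← hE, ← hE, ← h q hq, ← h' q hq]) hq
      simpa [Finsupp.single_apply] using congrArg (b.coord j) this

/-- The log affine structure defined by the scaling fields `∑ⱼ uⱼ yⱼ ∂ⱼ` of an adapted chart. -/
noncomputable def logAffineStructure [Finite ι] : LogAffineStructure n D U where
  freeDivisor := A.isFreeDivisor
  ρ := scalingField M b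
  smooth_ρ u := contMDiffOn_univ.1 <| (contMDiffOn_vectorField_iff A.chartAt_eq).2 <|
    A.contMDiffOn_scalingField b (a := fun _ => u) contMDiffOn_const
  lie_ρ u v q := by
    rw [A.mlieBracket_scalingField b isOpen_univ (a := fun _ => u) (a' := fun _ => v)
      contMDiffOn_const contMDiffOn_const (fun _ _ => rfl) (fun _ _ => rfl) (mem_univ q)]
    simp only [derivAlong, mfderiv_const]
    change scalingField M b ((0 : U) - (0 : U)) q = 0
    rw [sub_zero, map_zero]
    rfl
  ξ := scalingForm b
  smooth_ξ W V hW hV := (A.scalingForm_spec b hW hV).1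
  linear_ξ W V V' f g hW hV hV' hf hg := by
    obtain ⟨ha, haV⟩ := A.scalingForm_spec b hW hV
    obtain ⟨ha', haV'⟩ := A.scalingForm_spec b hW hV'
    refine A.scalingForm_eqOn b hW ((hf.smul ha).add (hg.smul ha')) fun q hq => ?_
    have := congrFun ((scalingField M b).map_add (f q • scalingForm b W V q)
      (g q • scalingForm b W V' q)) q
    refine this.trans ?_
    rw [map_smul, map_smul, Pi.add_apply, Pi.smul_apply, Pi.smul_apply, haV q hq, haV' q hq]
  restrict_ξ W W' V V' hW hW' hWW' hV hV' h := by
    obtain ⟨ha, haV⟩ := A.scalingForm_spec b hW hV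
    exact (A.scalingForm_eqOn b hW' (ha.mono hWW')
      fun q hq => (haV q (hWW' hq)).trans (h q hq)).symm
  injective_ξ W V V' hW hV hV' h q hq := by
    rw [← (A.scalingForm_spec b hW hV).2 q hq, ← (A.scalingForm_spec b hW hV').2 q hq, h hq]
  surjective_ξ W a hW ha :=
    ⟨_, A.isLogVectorField_scalingField b ha, A.scalingForm_eqOn b hW ha fun _ _ => rfl⟩
  anchor_ξ W V hW hV := (A.scalingForm_spec b hW hV).2
  bracket_ξ W V V' hW hV hV' := by
    obtain ⟨ha, haV⟩ := A.scalingForm_spec b hW hV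
    obtain ⟨ha', haV'⟩ := A.scalingForm_spec b hW hV'
    refine A.scalingForm_eqOn b hW ?_ fun q hq =>
      (A.mlieBracket_scalingField b hW ha ha' haV haV' hq).symm
    exact (contMDiffOn_mfderiv_apply A.chartAt_eq hW ha'
        ((contMDiffOn_vectorField_iff A.chartAt_eq).1 hV.1)).sub
      (contMDiffOn_mfderiv_apply A.chartAt_eq hW ha
        ((contMDiffOn_vectorField_iff A.chartAt_eq).1 hV'.1))

/-- The residue along `yⱼ = 0` is `bⱼ`: in the logarithmic form `∑ₗ yₗ⁻¹ dyₗ ⊗ bₗ`, only the term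
with `l = j` has a pole there. -/
theorem hasResidue [Finite ι] (i : ι) :
    (A.logAffineStructure b).HasResidue i fun _ => b (idx i) := by
  intro p hp
  refine ⟨univ, fun q => quadrantCoords n q (idx i), fun _ => b (idx i), isOpen_univ, mem_univ p,
    (A.contMDiff_coord _).contMDiffOn, fun q _ => (A.mem_iff i q).symm, fun q _ h => ?_,
    contMDiffOn_const, fun _ _ => rfl, fun W _ hW V hV => ?_⟩
  · rw [(A.hasMFDerivAt_coord q (idx i)).mfderiv] at h
    have h1 : (EuclideanSpace.single (idx i) (1 : ℝ) : EuclideanSpace ℝ (Fin n)) (idx i) = 0 :=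
      DFunLike.congr_fun (F := EuclideanSpace ℝ (Fin n) →L[ℝ] ℝ) h
        (EuclideanSpace.single (idx i) 1)
    simp at h1
  let V₀ : M → EuclideanSpace ℝ (Fin n) := V
  have hV' : ContMDiffOn (𝓠 n) 𝓘(ℝ, EuclideanSpace ℝ (Fin n)) ∞ V₀ W :=
    (contMDiffOn_vectorField_iff A.chartAt_eq).1 hV.1
  have hg (l : Fin n) : ∃ g : M → ℝ, ContMDiffOn (𝓠 n) 𝓘(ℝ, ℝ) ∞ g W ∧
      (l = idx i → g = 0) ∧
      (l ≠ idx i → ∀ q ∈ W, V₀ q l = quadrantCoords n q l * g q) := by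
    rcases eq_or_ne l (idx i) with h | h
    · exact ⟨0, contMDiffOn_const, fun _ => rfl, fun h' => (h' h).elim⟩
    · obtain ⟨g, hg, hVg⟩ := A.exists_component_eq_coord_mul hW hV' l
        fun m hm => hV.2 ⟨m, fun hmi => h (by rw [← hm, hmi])⟩
      exact ⟨g, hg, fun h' => (h h').elim, fun _ => hVg⟩
  -- no information on the component `idx i` is available; it is the polar part
  choose g hg hg0 hVg using hg
  refine ⟨fun q => ∑ l, g l q • b l, contMDiffOn_sum_smul_basis b hg, ?_⟩
  have hWi : IsOpen (W \ D i) := hW.sdiff (A.isClosed i)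
  have hne : ∀ q ∈ W \ D i, quadrantCoords n q (idx i) ≠ 0 := fun q hq h =>
    hq.2 ((A.mem_iff i q).2 h)
  have hder (q : M) : derivAlong (fun q => quadrantCoords n q (idx i)) q (V q) =
      V₀ q (idx i) := by
    rw [derivAlong, (A.hasMFDerivAt_coord q (idx i)).mfderiv]
    rfl
  have hpole : ContMDiffOn (𝓠 n) 𝓘(ℝ, ℝ) ∞ (fun q => (quadrantCoords n q (idx i))⁻¹ *
      derivAlong (fun q => quadrantCoords n q (idx i)) q (V q)) (W \ D i) :=
    ((A.contMDiff_coord _).contMDiffOn.inv₀ hne).mul <| (((EuclideanSpace.proj (𝕜 := ℝ)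
      (idx i)).contMDiff (n := ∞)).comp_contMDiffOn (hV'.mono sdiff_subset)).congr
        fun q _ => hder q
  refine A.scalingForm_eqOn b hWi ((hpole.smul contMDiffOn_const).add
    ((contMDiffOn_sum_smul_basis b hg).mono sdiff_subset)) fun q hq => ?_
  refine PiLp.ext fun l => ?_
  rw [hder]
  change diagonalScaling b _ (quadrantCoords n q) l = V₀ q l
  rw [diagonalScaling_apply]
  rcases eq_or_ne l (idx i) with rfl | h
  · have := hne q hq
    simp [Finsupp.single_apply, hg0 _ rfl]
    field_simp
  · simp [Finsupp.single_apply, hVg l h q hq.1, h.symm, mul_comm]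

/-- An action of `U` which multiplies the coordinates `yⱼ` by `exp uⱼ` integrates the scaling
fields. -/
theorem integratesTo [Finite ι] (act : AddAction U M)
    (hact : ∀ (u : U) (q : M) (j : Fin n), quadrantCoords n (u +ᵥ q) j =
      Real.exp (b.coord j u) * quadrantCoords n q j) :
    (A.logAffineStructure b).IntegratesTo act := by
  constructor
  · refine A.contMDiff_of_coords ?_
    have h1 (j : Fin n) : ContMDiff (𝓘(ℝ, U).prod (𝓠 n)) 𝓘(ℝ, ℝ) ∞
        fun p : U × M => Real.exp (b.coord j p.1) * quadrantCoords n p.2 j := by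
      have h2 : ContDiff ℝ ∞ fun u : U => Real.exp (b.coord j u) :=
        Real.contDiff_exp.comp (LinearMap.toContinuousLinearMap (b.coord j)).contDiff
      exact (h2.contMDiff.comp contMDiff_fst).mul ((A.contMDiff_coord j).comp contMDiff_snd)
    have h3 := (PiLp.continuousLinearEquiv 2 ℝ
      (fun _ : Fin n => ℝ)).symm.toContinuousLinearMap.contMDiff (n := ∞)
    refine (h3.comp (contMDiff_pi_space.2 h1)).congr fun p => ?_
    exact PiLp.ext fun j => hact p.1 p.2 j
  · intro u q t
    have hc : quadrantCoords n ∘ (fun t : ℝ => (t • u) +ᵥ q) = fun t : ℝ =>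
        (WithLp.toLp 2 fun j => Real.exp (t * b.coord j u) * quadrantCoords n q j :
          EuclideanSpace ℝ (Fin n)) := by
      funext t
      refine PiLp.ext fun j => (hact _ _ j).trans ?_
      rw [map_smul, smul_eq_mul]
    refine ⟨(A.isInducing_coords.continuous_iff.2 ?_).continuousAt, ?_⟩
    · rw [hc]
      fun_prop
    · have hw : writtenInExtChartAt 𝓘(ℝ, ℝ) (𝓠 n) t (fun t : ℝ => (t • u) +ᵥ q) =
          quadrantCoords n ∘ (fun t : ℝ => (t • u) +ᵥ q) := by
        funext s
        exact A.extChartAt_apply _ _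
      have hq : (quadrantCoords n ((t • u) +ᵥ q) : EuclideanSpace ℝ (Fin n)) =
          WithLp.toLp 2 fun j => Real.exp (t * b.coord j u) * quadrantCoords n q j :=
        congrFun hc t
      have hd : HasDerivAt (fun t : ℝ =>
          (WithLp.toLp 2 fun j => Real.exp (t * b.coord j u) * quadrantCoords n q j :
            EuclideanSpace ℝ (Fin n)))
          (diagonalScaling b u (quadrantCoords n ((t • u) +ᵥ q))) t := by
        rw [hq, hasDerivAt_iff_hasFDerivAt, ← hasFDerivWithinAt_univ, hasFDerivWithinAt_euclidean]
        intro j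
        have := (((hasDerivAt_id t).mul_const (b.coord j u)).exp).mul_const (quadrantCoords n q j)
        refine (this.hasFDerivAt.congr_fderiv (ContinuousLinearMap.ext_ring ?_)).hasFDerivWithinAt
        simp [diagonalScaling_apply]
        ring
      rw [hw, hc]
      exact hd.hasFDerivAt.hasFDerivWithinAt

end IsAdaptedChart

/-! ### Global coordinates on the quotient -/

theorem exists_basis_extending {U : Type*} [NormedAddCommGroup U] [NormedSpace ℝ U]
    [FiniteDimensional ℝ U] {n k : ℕ} (hn : Module.finrank ℝ U = n) {α : Fin k → U}
    (hα : LinearIndependent ℝ α) :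
    ∃ (b : Module.Basis (Fin n) ℝ U) (σ : Fin k → Fin n), Function.Injective σ ∧
      ∀ i, b (σ i) = α i := by
  have hs : LinearIndepOn ℝ id (range α) := hα.linearIndepOn_id
  let B := Module.Basis.extend hs
  let : Fintype (hs.extend (subset_univ _)) := FiniteDimensional.fintypeBasisIndex B
  let e := Fintype.equivFinOfCardEq ((Module.finrank_eq_card_basis B).symm.trans hn)
  refine ⟨B.reindex e, fun i => e ⟨α i, hs.subset_extend _ (mem_range_self i)⟩, ?_, fun i => ?_⟩
  · intro i j hij
    exact hα.injective (congrArg Subtype.val (e.injective hij))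
  · rw [Module.Basis.reindex_apply, e.symm_apply_apply]
    exact Module.Basis.extend_apply_self hs _

theorem isAdaptedChart_quadrant (k : ℕ) :
    IsAdaptedChart (M := EuclideanQuadrant k) (fun i => {l | l.1 i = 0}) id where
  chartAt_eq _ _ := rfl
  idx_injective := Function.injective_id
  mem_iff _ _ := Iff.rfl
  pos j hj := (hj ⟨j, rfl⟩).elim

section Coordinates

variable {U X : Type*} [NormedAddCommGroup U] [NormedSpace ℝ U] [MetricSpace X]
  [NormedAddTorsor U X] {n k : ℕ}

/-- The invariants of the antidiagonal action: with `tⱼ` the coordinates of `x - o` in the basis `b`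
which extends `α` along `σ`, these are `exp tⱼ * λᵢ` for `j = σ i`, and `exp tⱼ` for the
other `j`. -/
noncomputable def cornerCoords (b : Module.Basis (Fin n) ℝ U) (σ : Fin k → Fin n) (o x : X)
    (l : EuclideanQuadrant k) : EuclideanQuadrant n :=
  ⟨WithLp.toLp 2 fun j => Real.exp (b.coord j (x -ᵥ o)) * Function.extend σ l.1 1 j, fun j =>
    mul_nonneg (Real.exp_pos _).le <| by
      by_cases hj : ∃ i, σ i = j
      · rw [Function.extend, dif_pos hj]
        exact l.2 _
      · rw [Function.extend_apply' _ _ _ hj]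
        exact zero_le_one⟩

theorem cornerCoords_apply (b : Module.Basis (Fin n) ℝ U) (σ : Fin k → Fin n) (o x : X)
    (l : EuclideanQuadrant k) (j : Fin n) : (cornerCoords b σ o x l).1 j =
      Real.exp (b.coord j (x -ᵥ o)) * Function.extend σ l.1 1 j := rfl

/-- The translation part of a section of `cornerCoords` over its image: `∑ⱼ (log yⱼ) bⱼ`, the sum
being over the `j` which are not in the range of `σ`. -/
noncomputable def cornerShift (b : Module.Basis (Fin n) ℝ U) (σ : Fin k → Fin n)
    (y : EuclideanSpace ℝ (Fin n)) : U :=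
  b.equivFun.symm (Function.extend σ 0 fun j => Real.log (y j))

/-- The `ℝ₊ᵏ` part of a section of `cornerCoords` over its image. -/
def cornerFace (σ : Fin k → Fin n) (y : EuclideanQuadrant n) : EuclideanQuadrant k :=
  ⟨WithLp.toLp 2 fun i => y.1 (σ i), fun i => y.2 (σ i)⟩

variable (b : Module.Basis (Fin n) ℝ U) {σ : Fin k → Fin n} (hσ : Function.Injective σ)

include hσ in
theorem cornerCoords_section (o : X) {y : EuclideanQuadrant n} (hy : ∀ j ∉ range σ, 0 < y.1 j) :
    cornerCoords b σ o (cornerShift b σ y.1 +ᵥ o) (cornerFace σ y) = y := by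
  refine EuclideanQuadrant.ext _ _ (PiLp.ext fun j => ?_)
  have h : b.coord j (cornerShift b σ y.1) = Function.extend σ 0 (fun j => Real.log (y.1 j)) j := by
    rw [cornerShift, Module.Basis.coord_equivFun_symm]
  rw [cornerCoords_apply, vadd_vsub, h]
  by_cases hj : j ∈ range σ
  · obtain ⟨i, rfl⟩ := hj
    rw [hσ.extend_apply, hσ.extend_apply, Pi.zero_apply, Real.exp_zero, one_mul]
    rfl
  · rw [Function.extend_apply' _ _ _ hj, Function.extend_apply' _ _ _ hj, Real.exp_log (hy j hj),
      Pi.one_apply, mul_one]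

theorem cornerCoords_pos (o x : X) (l : EuclideanQuadrant k) {j : Fin n} (hj : j ∉ range σ) :
    0 < (cornerCoords b σ o x l).1 j := by
  rw [cornerCoords_apply, Function.extend_apply' _ _ _ hj, Pi.one_apply, mul_one]
  exact Real.exp_pos _

variable {α : Fin k → U} (hb : ∀ i, b (σ i) = α i)

include hσ hb in
theorem coord_sum_smul (s : Fin k → ℝ) (j : Fin n) :
    b.coord j (∑ i, s i • α i) = Function.extend σ s 0 j := by
  simp only [map_sum, map_smul, ← hb, Module.Basis.coord_apply, Module.Basis.repr_self,
    Finsupp.single_apply, smul_eq_mul, mul_ite, mul_one, mul_zero]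
  by_cases hj : j ∈ range σ
  · obtain ⟨i, rfl⟩ := hj
    rw [hσ.extend_apply]
    simp [hσ.eq_iff]
  · rw [Function.extend_apply' _ _ _ hj]
    exact Finset.sum_eq_zero fun i _ => if_neg fun h => hj ⟨i, h⟩

include hσ hb in
/-- The fibres of `cornerCoords` are the orbits of the antidiagonal action. -/
theorem cornerCoords_eq_iff (o : X) (p p' : CornerSpace X α) :
    cornerCoords b σ o p.1 p.2 = cornerCoords b σ o p'.1 p'.2 ↔
      AddAction.orbitRel (Fin k → ℝ) (CornerSpace X α) p p' := by
  constructor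
  · intro h
    have h1 (j : Fin n) := congrArg (fun y : EuclideanQuadrant n => y.1 j) h
    simp only [cornerCoords_apply] at h1
    -- the group element is the difference of the components along `α`
    let s : Fin k → ℝ := fun i => b.coord (σ i) (p'.1 -ᵥ o) - b.coord (σ i) (p.1 -ᵥ o)
    refine ⟨s, Prod.ext ?_ (EuclideanQuadrant.ext _ _ (PiLp.ext fun i => ?_))⟩
    · change -(∑ i, s i • α i) +ᵥ p'.1 = p.1
      rw [← vsub_left_cancel_iff (p := o), vadd_vsub_assoc]
      refine b.ext_elem fun j => ?_
      change b.coord j _ = b.coord j _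
      rw [map_add, map_neg, coord_sum_smul b hσ hb]
      by_cases hj : j ∈ range σ
      · obtain ⟨i, rfl⟩ := hj
        rw [hσ.extend_apply]
        simp [s]
      · have h2 := h1 j
        rw [Function.extend_apply' _ _ _ hj, Function.extend_apply' _ _ _ hj, Pi.one_apply, mul_one,
          mul_one, Real.exp_eq_exp] at h2
        rw [Function.extend_apply' _ _ _ hj, Pi.zero_apply, neg_zero, zero_add, h2]
    · change Real.exp (s i) * p'.2.1 i = p.2.1 i
      have h2 := h1 (σ i)
      rw [hσ.extend_apply, hσ.extend_apply] at h2
      rw [Real.exp_sub, div_mul_eq_mul_div, ← h2, mul_div_cancel_left₀ _ (Real.exp_pos _).ne']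
  · rintro ⟨s, rfl⟩
    refine EuclideanQuadrant.ext _ _ (PiLp.ext fun j => ?_)
    change Real.exp (b.coord j ((-(∑ i, s i • α i) +ᵥ p'.1) -ᵥ o)) *
      Function.extend σ (expScale s p'.2).1 1 j = _
    rw [cornerCoords_apply, vadd_vsub_assoc, map_add, map_neg, coord_sum_smul b hσ hb]
    by_cases hj : j ∈ range σ
    · obtain ⟨i, rfl⟩ := hj
      have he : (expScale s p'.2).1 i = Real.exp (s i) * p'.2.1 i := rfl
      rw [hσ.extend_apply, hσ.extend_apply, hσ.extend_apply, he, Real.exp_add, Real.exp_neg]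
      have := (Real.exp_pos (s i)).ne'
      field_simp
    · rw [Function.extend_apply' _ _ _ hj, Function.extend_apply' _ _ _ hj,
        Function.extend_apply' _ _ _ hj]
      simp

variable [FiniteDimensional ℝ U]

theorem continuous_cornerCoords (σ : Fin k → Fin n) (o : X) :
    Continuous fun p : X × EuclideanQuadrant k => cornerCoords b σ o p.1 p.2 := by
  refine Continuous.subtype_mk ((PiLp.continuous_toLp 2 _).comp (continuous_pi fun j => ?_)) _
  have h1 := (LinearMap.toContinuousLinearMap (b.coord j)).continuous
  refine (Real.continuous_exp.comp (h1.comp (continuous_fst.vsub continuous_const))).mul ?_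
  by_cases hj : ∃ i, σ i = j
  · simp only [Function.extend, dif_pos hj]
    exact (PiLp.continuous_apply 2 _ _).comp (continuous_subtype_val.comp continuous_snd)
  · simp only [Function.extend_apply' _ _ _ hj]
    exact continuous_const

namespace CornerCompactification

/-- The coordinates of `cornerCoords`, as a partial homeomorphism from the whole quotient to the
open subset `{y | ∀ j ∉ range σ, 0 < y j}` of the quadrant. -/
noncomputable def chart (o : X) :
    OpenPartialHomeomorph (CornerCompactification X α) (EuclideanQuadrant n) where
  toFun := Quotient.lift (fun p : CornerSpace X α => cornerCoords b σ o p.1 p.2) fun p p' h =>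
    (cornerCoords_eq_iff b hσ hb o p p').2 h
  invFun y := mk α (cornerShift b σ y.1 +ᵥ o) (cornerFace σ y)
  source := univ
  target := {y | ∀ j ∉ range σ, 0 < y.1 j}
  map_source' q _ := by
    induction q using Quotient.inductionOn with
    | h p => exact fun j hj => cornerCoords_pos b o p.1 p.2 hj
  map_target' _ _ := mem_univ _
  left_inv' q _ := by
    induction q using Quotient.inductionOn with
    | h p =>
      refine Quotient.sound ((cornerCoords_eq_iff b hσ hb o _ _).1 ?_)
      exact cornerCoords_section b hσ o fun j hj => cornerCoords_pos b o p.1 p.2 hj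
  right_inv' y hy := cornerCoords_section b hσ o hy
  open_source := isOpen_univ
  open_target := by
    simp only [ofPred_forall]
    refine isOpen_iInter_of_finite fun j => isOpen_iInter_of_finite fun _ => ?_
    exact isOpen_lt continuous_const ((PiLp.continuous_apply 2 _ j).comp continuous_subtype_val)
  continuousOn_toFun :=
    Continuous.continuousOn ((continuous_cornerCoords b σ o).quotient_lift _)
  continuousOn_invFun := by
    refine continuous_quotient_mk'.comp_continuousOn (ContinuousOn.prodMk ?_ ?_)
    · refine ContinuousOn.vadd ?_ continuousOn_const
      refine (LinearMap.toContinuousLinearMap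
        b.equivFun.symm.toLinearMap).continuous.comp_continuousOn (continuousOn_pi.2 fun j => ?_)
      by_cases hj : j ∈ range σ
      · obtain ⟨i, rfl⟩ := hj
        simp only [hσ.extend_apply]
        exact continuousOn_const
      · simp only [Function.extend_apply' _ _ _ hj]
        exact ((PiLp.continuous_apply 2 _ j).comp continuous_subtype_val).continuousOn.log
          fun y hy => (hy j hj).ne'
    · exact (Continuous.subtype_mk ((PiLp.continuous_toLp 2 _).comp (continuous_pi fun i =>
        (PiLp.continuous_apply 2 (fun _ : Fin n => ℝ) (σ i)).comp
          continuous_subtype_val)) _).continuousOn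

theorem chart_symm_apply (o : X) (y : EuclideanQuadrant n) :
    (chart b hσ hb o).symm y = mk α (cornerShift b σ y.1 +ᵥ o) (cornerFace σ y) := rfl

end CornerCompactification

end Coordinates

/-! ### The antidiagonal action and the quotient manifold -/

instance (n : ℕ) : T2Space (EuclideanQuadrant n) :=
  inferInstanceAs (T2Space {x : EuclideanSpace ℝ (Fin n) // ∀ i, 0 ≤ x i})

instance (n : ℕ) : SecondCountableTopology (EuclideanQuadrant n) :=
  inferInstanceAs (SecondCountableTopology {x : EuclideanSpace ℝ (Fin n) // ∀ i, 0 ≤ x i})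

section Action

variable {U X : Type*} [NormedAddCommGroup U] [NormedSpace ℝ U] [MetricSpace X]
  [NormedAddTorsor U X] {n k : ℕ} (b : Module.Basis (Fin n) ℝ U) {σ : Fin k → Fin n}
  (hσ : Function.Injective σ) {α : Fin k → U} (hb : ∀ i, b (σ i) = α i)

theorem antidiagonalAction_free (hα : LinearIndependent ℝ α) (s : Fin k → ℝ)
    (p : CornerSpace X α) (h : s +ᵥ p = p) : s = 0 := by
  have h1 : -(∑ i, s i • α i) +ᵥ p.1 = p.1 := congrArg Prod.fst h
  have h2 : ∑ i, s i • α i = 0 := neg_eq_zero.1 ((vadd_right_cancel_iff p.1).1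
    (h1.trans (zero_vadd U p.1).symm))
  exact funext (Fintype.linearIndependent_iff.1 hα s h2)

include hσ hb in
/-- The map `(s, p) ↦ (s +ᵥ p, p)` is a closed embedding, since `s` can be recovered from the
components of `s +ᵥ p` and `p` in the affine space. -/
theorem properVAdd_antidiagonalAction [FiniteDimensional ℝ U] :
    ProperVAdd (Fin k → ℝ) (CornerSpace X α) := by
  let g : (Fin k → ℝ) × (X × EuclideanQuadrant k) →
      (X × EuclideanQuadrant k) × (X × EuclideanQuadrant k) := fun p =>
    ((-(∑ i, p.1 i • α i) +ᵥ p.2.1, expScale p.1 p.2.2), p.2)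
  let f : (X × EuclideanQuadrant k) × (X × EuclideanQuadrant k) →
      (Fin k → ℝ) × (X × EuclideanQuadrant k) := fun p =>
    (fun i => b.coord (σ i) (p.2.1 -ᵥ p.1.1), p.2)
  have hf : Continuous f := by
    have h (j : Fin n) : Continuous (b.coord j) :=
      (LinearMap.toContinuousLinearMap (b.coord j)).continuous
    have h1 : Continuous fun p : (X × EuclideanQuadrant k) × (X × EuclideanQuadrant k) =>
        p.2.1 -ᵥ p.1.1 := continuous_snd.fst.vsub continuous_fst.fst
    exact (continuous_pi fun i => (h (σ i)).comp h1).prodMk continuous_snd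
  have hg : Continuous g := by
    have h : Continuous fun s : Fin k → ℝ => -(∑ i, s i • α i) := by fun_prop
    have h1 : Continuous fun p : (Fin k → ℝ) × (X × EuclideanQuadrant k) =>
        -(∑ i, p.1 i • α i) +ᵥ p.2.1 :=
      (h.comp continuous_fst).vadd (continuous_fst.comp continuous_snd)
    have h2 : Continuous fun p : (Fin k → ℝ) × EuclideanQuadrant k => expScale p.1 p.2 := by
      refine Continuous.subtype_mk ((PiLp.continuous_toLp 2 _).comp (continuous_pi fun i => ?_)) _
      exact (Real.continuous_exp.comp ((continuous_apply i).comp continuous_fst)).mul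
        ((PiLp.continuous_apply 2 (fun _ : Fin k => ℝ) i).comp
          (continuous_subtype_val.comp continuous_snd))
    exact (h1.prodMk (h2.comp (continuous_fst.prodMk
      (continuous_snd.comp continuous_snd)))).prodMk continuous_snd
  have hfg : Function.LeftInverse f g := by
    rintro ⟨s, x, l⟩
    refine Prod.ext (funext fun i => ?_) rfl
    change b.coord (σ i) (x -ᵥ (-(∑ i, s i • α i) +ᵥ x)) = s i
    rw [vsub_vadd_eq_vsub_sub, vsub_self, zero_sub, neg_neg, coord_sum_smul b hσ hb,
      hσ.extend_apply]
  have hp : IsProperMap g := (hfg.isClosedEmbedding hf hg).isProperMap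
  exact ⟨hp⟩

namespace CornerCompactification

variable [FiniteDimensional ℝ U]

/-- The structure of a manifold with corners whose only chart is `chart`. -/
@[reducible]
noncomputable def chartedSpace (o : X) :
    ChartedSpace (EuclideanQuadrant n) (CornerCompactification X α) :=
  (chart b hσ hb o).singletonChartedSpace rfl

theorem isEmbedding_chart (o : X) : IsEmbedding (chart (α := α) b hσ hb o) :=
  ((chart b hσ hb o).isOpenEmbedding rfl).isEmbedding

theorem isManifold (o : X) :
    letI := chartedSpace b hσ hb o
    IsManifold (𝓠 n) ∞ (CornerCompactification X α) :=
  (chart b hσ hb o).isManifold_singleton rfl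

theorem quadrantCoords_mk (o x : X) (l : EuclideanQuadrant k) :
    letI := chartedSpace b hσ hb o
    quadrantCoords n (mk α x l) = (cornerCoords b σ o x l).1 := rfl

/-- The residual action multiplies the coordinates by exponentials. -/
theorem quadrantCoords_vadd (o : X) (u : U) (q : CornerCompactification X α) (j : Fin n) :
    letI := chartedSpace b hσ hb o
    quadrantCoords n (u +ᵥ q) j = Real.exp (b.coord j u) * quadrantCoords n q j := by
  let _ := chartedSpace (α := α) (X := X) b hσ hb o
  induction q using Quotient.inductionOn with
  | h p =>
    change Real.exp (b.coord j ((u +ᵥ p.1) -ᵥ o)) * Function.extend σ p.2.1 1 j =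
      Real.exp (b.coord j u) * (Real.exp (b.coord j (p.1 -ᵥ o)) * Function.extend σ p.2.1 1 j)
    rw [vadd_vsub_assoc, map_add, Real.exp_add, mul_assoc]

theorem mem_boundaryStratum_iff (o : X) (i : Fin k) (q : CornerCompactification X α) :
    letI := chartedSpace b hσ hb o
    q ∈ boundaryStratum X α i ↔ quadrantCoords n q (σ i) = 0 := by
  let _ := chartedSpace (α := α) (X := X) b hσ hb o
  have key (x : X) (l : EuclideanQuadrant k) :
      quadrantCoords n (mk α x l) (σ i) = 0 ↔ l.1 i = 0 := by
    rw [quadrantCoords_mk, cornerCoords_apply, hσ.extend_apply]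
    exact mul_eq_zero_iff_left (Real.exp_pos _).ne'
  constructor
  · rintro ⟨x, l, hl, rfl⟩
    exact (key x l).2 hl
  · induction q using Quotient.inductionOn with
    | h p => exact fun h => ⟨p.1, p.2, (key p.1 p.2).1 h, rfl⟩

theorem isAdaptedChart (o : X) :
    letI := chartedSpace b hσ hb o
    IsAdaptedChart (boundaryStratum X α) σ := by
  let _ := chartedSpace (α := α) (X := X) b hσ hb o
  exact
  { chartAt_eq := fun _ _ => rfl
    idx_injective := hσ
    mem_iff := mem_boundaryStratum_iff b hσ hb o
    pos := fun j hj q => (chart b hσ hb o).map_source (mem_univ q) j hj }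

theorem boundary_eq (o : X) :
    letI := chartedSpace b hσ hb o
    (𝓠 n).boundary (CornerCompactification X α) = ⋃ i, boundaryStratum X α i := by
  let _ := chartedSpace (α := α) (X := X) b hσ hb o
  have A := isAdaptedChart (α := α) b hσ hb o
  ext q
  rw [← ModelWithCorners.compl_interior, mem_compl_iff, mem_iUnion]
  have h1 : q ∈ (𝓠 n).interior (CornerCompactification X α) ↔ ∀ j, 0 < quadrantCoords n q j := by
    change quadrantCoords n q ∈ interior (range (𝓠 n)) ↔ _
    rw [show range (𝓠 n) = _ from range_euclideanQuadrant n, interior_euclideanQuadrant]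
    rfl
  rw [h1, not_forall]
  constructor
  · rintro ⟨j, hj⟩
    by_cases hjσ : j ∈ range σ
    · obtain ⟨i, rfl⟩ := hjσ
      exact ⟨i, (A.mem_iff i q).2 (le_antisymm (not_lt.1 hj) (quadrantCoords_nonneg q _))⟩
    · exact (hj (A.pos j hjσ q)).elim
  · rintro ⟨i, hi⟩
    exact ⟨σ i, ((A.mem_iff i q).1 hi).le.not_gt⟩

/-- The projection is smooth, and so is the section of it given by `cornerShift` and
`cornerFace`. -/
theorem isQuotientSmoothStructure (o : X) :
    letI := chartedSpace b hσ hb o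
    IsQuotientSmoothStructure (X := X) α n := by
  let _ := chartedSpace (α := α) (X := X) b hσ hb o
  have : IsManifold (𝓠 n) ∞ (CornerCompactification X α) := isManifold b hσ hb o
  have A := isAdaptedChart (α := α) b hσ hb o
  have A' := isAdaptedChart_quadrant k
  intro o' W hW f π
  have hπ : ContMDiff (𝓘(ℝ, U).prod (𝓠 k)) (𝓠 n) ∞ π := by
    refine A.contMDiff_of_coords ?_
    have h1 (j : Fin n) : ContMDiff (𝓘(ℝ, U).prod (𝓠 k)) 𝓘(ℝ, ℝ) ∞
        fun p : U × EuclideanQuadrant k =>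
          Real.exp (b.coord j ((p.1 +ᵥ o') -ᵥ o)) * Function.extend σ p.2.1 1 j := by
      refine ContMDiff.mul ?_ ?_
      · have h2 : ContDiff ℝ ∞ fun u : U => Real.exp (b.coord j ((u +ᵥ o') -ᵥ o)) := by
          simp only [vadd_vsub_assoc]
          exact Real.contDiff_exp.comp ((LinearMap.toContinuousLinearMap (b.coord j)).contDiff.comp
            (contDiff_id.add contDiff_const))
        exact h2.contMDiff.comp contMDiff_fst
      · by_cases hj : j ∈ range σ
        · obtain ⟨i, rfl⟩ := hj
          simp only [hσ.extend_apply]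
          exact (A'.contMDiff_coord i).comp contMDiff_snd
        · simp only [Function.extend_apply' _ _ _ hj]
          exact contMDiff_const
    have h3 := (PiLp.continuousLinearEquiv 2 ℝ
      (fun _ : Fin n => ℝ)).symm.toContinuousLinearMap.contMDiff (n := ∞)
    exact h3.comp (contMDiff_pi_space.2 h1)
  let τ : CornerCompactification X α → U × EuclideanQuadrant k := fun q =>
    (cornerShift b σ (quadrantCoords n q) - (o' -ᵥ o), cornerFace σ (chart b hσ hb o q))
  have hτ : ContMDiff (𝓠 n) (𝓘(ℝ, U).prod (𝓠 k)) ∞ τ := by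
    refine ContMDiff.prodMk ?_ (A'.contMDiff_of_coords ?_)
    · refine ContMDiff.sub ?_ contMDiff_const
      refine ((LinearMap.toContinuousLinearMap
        b.equivFun.symm.toLinearMap).contMDiff (n := ∞)).comp (contMDiff_pi_space.2 fun j => ?_)
      by_cases hj : j ∈ range σ
      · obtain ⟨i, rfl⟩ := hj
        simp only [hσ.extend_apply]
        exact contMDiff_const
      · simp only [Function.extend_apply' _ _ _ hj]
        exact fun q => (Real.contDiffAt_log.2 (A.pos j hj q).ne').contMDiffAt.comp q
          (A.contMDiff_coord j q)
    · have h3 := (PiLp.continuousLinearEquiv 2 ℝ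
        (fun _ : Fin k => ℝ)).symm.toContinuousLinearMap.contMDiff (n := ∞)
      exact h3.comp (contMDiff_pi_space.2 fun i => A.contMDiff_coord (σ i))
  have hπτ (q : CornerCompactification X α) : π (τ q) = q := by
    refine Eq.trans ?_ ((chart b hσ hb o).left_inv (mem_univ q))
    rw [chart_symm_apply]
    refine congrArg (fun x => mk α x _) ?_
    change (cornerShift b σ _ - (o' -ᵥ o)) +ᵥ o' = cornerShift b σ _ +ᵥ o
    rw [sub_eq_add_neg, add_vadd, neg_vsub_eq_vsub_rev, vsub_vadd]
    rfl
  constructor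
  · exact fun h => h.comp hπ.contMDiffOn fun p hp => hp
  · intro h
    have hW' : MapsTo τ W (π ⁻¹' W) := fun q hq => (congrArg (· ∈ W) (hπτ q)).mpr hq
    exact (h.comp hτ.contMDiffOn hW').congr fun q _ => (congrArg f (hπτ q)).symm

end CornerCompactification

end Action

theorem mainTheorem8 {U X : Type*} [NormedAddCommGroup U] [NormedSpace ℝ U]
    [FiniteDimensional ℝ U] [MetricSpace X] [NormedAddTorsor U X]
    {n k : ℕ} (hn : Module.finrank ℝ U = n) (α : Fin k → U) (hα : LinearIndependent ℝ α) :
    -- the antidiagonal action is free and proper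
    (∀ (s : Fin k → ℝ) (p : CornerSpace X α), s +ᵥ p = p → s = 0) ∧
    ProperVAdd (Fin k → ℝ) (CornerSpace X α) ∧
    -- the quotient is an `n`-manifold with corners
    T2Space (CornerCompactification X α) ∧
    SecondCountableTopology (CornerCompactification X α) ∧
    ∃ (_ : ChartedSpace (EuclideanQuadrant n) (CornerCompactification X α))
      (_ : IsManifold (modelWithCornersEuclideanQuadrant n) ∞ (CornerCompactification X α)),
      IsQuotientSmoothStructure (X := X) α n ∧
      (modelWithCornersEuclideanQuadrant n).boundary (CornerCompactification X α) =
        ⋃ i, CornerCompactification.boundaryStratum X α i ∧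
      -- the residual action makes it a complete log affine manifold, with residues `αᵢ`
      ∃ L : LogAffineStructure n (CornerCompactification.boundaryStratum X α) U,
        L.IntegratesTo (CornerCompactification.residualAction α) ∧ L.IsComplete ∧
        ∀ i, L.HasResidue i (fun _ => α i) := by
  obtain ⟨b, σ, hσ, hb⟩ := exists_basis_extending hn hα
  obtain ⟨o⟩ : Nonempty X := inferInstance
  have hemb := CornerCompactification.isEmbedding_chart b hσ hb o
  refine ⟨antidiagonalAction_free hα, properVAdd_antidiagonalAction b hσ hb, hemb.t2Space,
    hemb.secondCountableTopology, CornerCompactification.chartedSpace b hσ hb o,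
    CornerCompactification.isManifold b hσ hb o,
    CornerCompactification.isQuotientSmoothStructure b hσ hb o,
    CornerCompactification.boundary_eq b hσ hb o, ?_⟩
  let _ := CornerCompactification.chartedSpace b hσ hb o
  have := CornerCompactification.isManifold b hσ hb o
  have A := CornerCompactification.isAdaptedChart b hσ hb o
  have hact := A.integratesTo b (CornerCompactification.residualAction α)
    (CornerCompactification.quadrantCoords_vadd b hσ hb o)
  exact ⟨A.logAffineStructure b, hact, ⟨_, hact⟩, fun i => hb i ▸ A.hasResidue b i⟩
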